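/- **Setting.** Let $U$ be an $n$-qubit circuit of single-qubit gates and $CZ$ gates, $|\psi_t\rangle=U|0^n\rangle$. Divide the $n$ qubits into a set $A$ of $m\ge n/2$ qubits and its complement $B$ of $n-m$ qubits, and let $D$ be the number of $CZ$ gates of $U$ between $A$ and $B$. (For sparse states $m,\,n-m=\Theta(n)$ and $D=O(\log n)$, $U$ having polynomially many gates; the statement holds without these restrictions.) For $\mathbf i\in\{0,1\}^D$ let $V_{\mathbf i}$ (resp. $W_{\mathbf i}$) be the unitary on $A$ (resp. $B$) obtained from $U$ by keeping the gates inside $A$ (resp. $B$) and replacing, for each $k$, the $k$-th $CZ$ gate across the cut by $Z^{i_k}$ on its endpoint in $A$ (resp. $B$), so that $U=2^{-D}\sum_{\mathbf i,\mathbf j}(-1)^{\mathbf i\cdot\mathbf j}V_{\mathbf i}\otimes W_{\mathbf j}$. Write $\Lambda(Q)=|0\rangle\langle0|\otimes I+|1\rangle\langle1|\otimes Q$, with control on an ancilla on which $H,X,C_{\mathbf l}$ also act, and for $\mathbf l\in\{0,1\}^3$ let $C_{\mathbf l}=S^{\delta_{l_1,1}\delta_{l_2,0}}H^{\delta_{l_1+l_2,1}}X^{l_3}$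 with $S=\mathrm{diag}(1,i)$. Put $$D^{(1)}_{\mathbf i,\mathbf i',\mathbf l}=C_{\mathbf l}^\dagger\Lambda(V_{\mathbf i'}^\dagger)X\Lambda(V_{\mathbf i}^\dagger)XH,\qquad D^{(2)}_{\mathbf j,\mathbf j',\mathbf l}=H\Lambda(W_{\mathbf j'}^\dagger)X\Lambda(W_{\mathbf j}^\dagger)XC_{\mathbf l},$$ both regarded as $(m+1)$-qubit gates ($D^{(2)}$ acts trivially on the $2m-n$ unused qubits). The actual operations are CPTP maps $\mathcal E^{(1)}_{\mathbf i,\mathbf i',\mathbf l},\mathcal E^{(2)}_{\mathbf j,\mathbf j',\mathbf l}$ on $m+1$ qubits. **One run** on a copy of $\hat\rho_{\rm out}$, for given $\mathbf k,\mathbf i,\mathbf j,\mathbf i',\mathbf j',\mathbf l$: apply $\mathcal E^{(1)}_{\mathbf i,\mathbf i',\mathbf l}$ to an ancilla $|0\rangle$ and the qubits in $A$, and $\mathcal E^{(2)}_{\mathbf j,\mathbf j',\mathbf l}$ to an ancilla $|0\rangle$, the qubits in $B$ and unused qubits in $|0\rangle$; measure everything in the computational basis, giving $\mathbf z\in\{0,1\}^n$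 from the qubits of $\hat\rho_{\rm out}$ and $o$, $b$ from the first and second ancilla. The result of the run is $\beta=(-1)^{(1+\delta_{l_1,0}\delta_{l_2,0})\,o}\,(-1)^{\mathbf z\cdot\mathbf k+\mathbf i\cdot\mathbf j+\mathbf i'\cdot\mathbf j'+b}$. **Algorithm 1** with parameters $T_1,T_2,T_3$: choose $\mathbf k\in\{0,1\}^n$ uniformly $T_1$ times; for each $\mathbf k$ choose $(\mathbf i,\mathbf j,\mathbf i',\mathbf j')\in(\{0,1\}^D)^4$ uniformly $T_2$ times; for each quadruple make $T_3$ runs for each $\mathbf l\in\{0,1\}^3$, and take half the sum over $\mathbf l$ of the means of $\beta$. All choices and runs are independent. For each $\mathbf k$ take $4^D$ times the average of these values over the $T_2$ quadruples, and let $F_{\rm est}$ be the average of the results over the $T_1$ strings $\mathbf k$. **Theorem 1.** There is an absolute constant $C>0$ such that for all integers $D\ge0$ and all $0<\epsilon,\delta<1$ there is an integer $T\ge1$ with $$8T^3\le C\,\frac{2^{12D}}{\epsilon^6}\Bigl(\max\Bigl\{1,\;D+\log\frac1{\delta\epsilon^4}\Bigr\}\Bigr)^3$$ such that the following holds for all $n$,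 $m$, $U$, $A$ as above with exactly $D$ $CZ$ gates across the cut. If each actual operation is within $\epsilon/4^{D+2}$ of its ideal one in diamond norm, $\|\mathcal E^{(1)}_{\mathbf i,\mathbf i',\mathbf l}-\mathcal D^{(1)}_{\mathbf i,\mathbf i',\mathbf l}\|_\diamond\le\epsilon/4^{D+2}$ and $\|\mathcal E^{(2)}_{\mathbf j,\mathbf j',\mathbf l}-\mathcal D^{(2)}_{\mathbf j,\mathbf j',\mathbf l}\|_\diamond\le\epsilon/4^{D+2}$ for all labels, where $\mathcal D(\cdot)=D(\cdot)D^\dagger$ (this is so if every $(m+1)$-qubit gate is realised to this precision), then for every $n$-qubit state $\hat\rho_{\rm out}$, Algorithm 1 with $T_1=T_2=T_3=T$ uses exactly $8T^3$ copies of $\hat\rho_{\rm out}$, performs only $(m+1)$-qubit operations and measurements on them, and outputs $F_{\rm est}$ with $|F_{\rm est}-\langle\psi_t|\hat\rho_{\rm out}|\psi_t\rangle|\le\epsilon$ with probability at least $1-\delta$. -/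

import Mathlib

open scoped Matrix Kronecker ComplexOrder ENNReal

namespace DivideConquer

noncomputable section

/-! ### Quantum states, quantum channels and the diamond norm -/

/-- Density matrices with rows and columns indexed by `d`.  A state of qubits labelled by `Q` is a
`State (Q → Fin 2)`. -/
structure State (d : Type) [Fintype d] where
  mat : Matrix d d ℂ
  posSemidef : mat.PosSemidef
  trace_one : mat.trace = 1

/-- The map `Φ ⊗ id` on `d × κ` matrices. -/
def ampLeft {d κ : Type} (Φ : Matrix d d ℂ →ₗ[ℂ] Matrix d d ℂ)
    (X : Matrix (d × κ) (d × κ) ℂ) : Matrix (d × κ) (d × κ) ℂ :=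
  fun a b => Φ (fun s t => X (s, a.2) (t, b.2)) a.1 b.1

/-- The map `id ⊗ Φ` on `κ × d` matrices. -/
def ampRight {d κ : Type} (Φ : Matrix d d ℂ →ₗ[ℂ] Matrix d d ℂ)
    (X : Matrix (κ × d) (κ × d) ℂ) : Matrix (κ × d) (κ × d) ℂ :=
  (ampLeft Φ (X.submatrix Prod.swap Prod.swap)).submatrix Prod.swap Prod.swap

/-- Completely positive trace-preserving maps on `d × d` matrices. -/
structure Channel (d : Type) [Fintype d] where
  map : Matrix d d ℂ →ₗ[ℂ] Matrix d d ℂ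
  completelyPositive : ∀ (κ : Type) [Finite κ] (X : Matrix (d × κ) (d × κ) ℂ),
    X.PosSemidef → (ampLeft map X).PosSemidef
  tracePreserving : ∀ X, (map X).trace = X.trace

/-- The map `X ↦ V X V†`. -/
def conjMap {d : Type} [Fintype d] (V : Matrix d d ℂ) : Matrix d d ℂ →ₗ[ℂ] Matrix d d ℂ where
  toFun X := V * X * Vᴴ
  map_add' X Y := by rw [mul_add, add_mul]
  map_smul' c X := by simp

/-- The Schatten 1-norm: the sum of the singular values. -/
def traceNorm {d : Type} [Fintype d] [DecidableEq d] (X : Matrix d d ℂ) : ℝ :=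
  ∑ s, √((Matrix.isHermitian_conjTranspose_mul_self X).eigenvalues s)

/-- The diamond norm `sup_k sup_{‖X‖₁ ≤ 1} ‖(Φ ⊗ id_k) X‖₁` (without a factor `1/2`), as an
extended nonnegative real. -/
def diamondNorm {d : Type} [Fintype d] [DecidableEq d]
    (Φ : Matrix d d ℂ →ₗ[ℂ] Matrix d d ℂ) : ℝ≥0∞ :=
  ⨆ (k : ℕ) (X : Matrix (d × Fin k) (d × Fin k) ℂ) (_ : traceNorm X ≤ 1),
    ENNReal.ofReal (traceNorm (ampLeft Φ X))

/-- The state `(Φ ⊗ Ψ)(σ)`. -/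
def State.applyTensor {d e : Type} [Fintype d] [Fintype e] (σ : State (d × e))
    (Φ : Channel d) (Ψ : Channel e) : State (d × e) where
  mat := ampLeft Φ.map (ampRight Ψ.map σ.mat)
  posSemidef := Φ.completelyPositive e _
    ((Ψ.completelyPositive d _ (σ.posSemidef.submatrix _)).submatrix _)
  trace_one := by
    have hL : ∀ (d κ : Type) [Fintype d] [Fintype κ] (Φ : Channel d)
        (X : Matrix (d × κ) (d × κ) ℂ), (ampLeft Φ.map X).trace = X.trace := by
      intro d κ _ _ Φ X
      simp only [Matrix.trace, Matrix.diag, Fintype.sum_prod_type_right]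
      refine Finset.sum_congr rfl fun r _ => ?_
      exact Φ.tracePreserving (fun s t => X (s, r) (t, r))
    have hS : ∀ (d κ : Type) [Fintype d] [Fintype κ] (X : Matrix (d × κ) (d × κ) ℂ),
        (X.submatrix (Prod.swap : κ × d → d × κ) Prod.swap).trace = X.trace := by
      intro d κ _ _ X
      exact (Equiv.prodComm κ d).sum_comp (fun a => X a a)
    rw [hL, ampRight, hS, hL, hS, σ.trace_one]

/-- The distribution of the outcome when all qubits of a state are measured in the computational
basis. -/
def State.measure {d : Type} [Fintype d] (σ : State d) : PMF d :=
  PMF.ofFintype (fun x => ENNReal.ofReal (σ.mat x x).re) (by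
    have h0 : ∀ x, 0 ≤ (σ.mat x x).re := fun x =>
      (Complex.le_def.1 (σ.posSemidef.diag_nonneg (i := x))).1
    rw [← ENNReal.ofReal_sum_of_nonneg fun x _ => h0 x, ← Complex.re_sum]
    have h := σ.trace_one
    simp only [Matrix.trace, Matrix.diag] at h
    rw [h]
    simp)

/-! ### Gates -/

def pauliX : Matrix (Fin 2) (Fin 2) ℂ := !![0, 1; 1, 0]

def pauliZ : Matrix (Fin 2) (Fin 2) ℂ := !![1, 0; 0, -1]

def hadamard : Matrix (Fin 2) (Fin 2) ℂ := ((1 / √2 : ℝ) : ℂ) • !![1, 1; 1, -1]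

def phaseS : Matrix (Fin 2) (Fin 2) ℂ := !![1, 0; 0, Complex.I]

/-- A single-qubit operator `u` acting on the qubit `q` and trivially on the others. -/
def onQubit {Q : Type} [Fintype Q] [DecidableEq Q] (q : Q) (u : Matrix (Fin 2) (Fin 2) ℂ) :
    Matrix (Q → Fin 2) (Q → Fin 2) ℂ :=
  fun x y => if ∀ p, p ≠ q → x p = y p then u (x q) (y q) else 0

/-- The controlled-`Z` gate on the qubits `c` and `t`. -/
def controlledZ {Q : Type} [Fintype Q] [DecidableEq Q] (c t : Q) :
    Matrix (Q → Fin 2) (Q → Fin 2) ℂ :=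
  Matrix.diagonal fun x => if x c = 1 ∧ x t = 1 then -1 else 1

/-- The gate set: all single-qubit gates and `CZ` on two distinct qubits. -/
inductive Gate (Q : Type) where
  | single (q : Q) (u : Matrix.unitaryGroup (Fin 2) ℂ)
  | cz (c t : Q) (hct : c ≠ t)

def Gate.matrix {Q : Type} [Fintype Q] [DecidableEq Q] :
    Gate Q → Matrix (Q → Fin 2) (Q → Fin 2) ℂ
  | .single q u => onQubit q (u : Matrix (Fin 2) (Fin 2) ℂ)
  | .cz c t _ => controlledZ c t

/-- The unitary implemented by a circuit; the gate at the head of the list is applied first. -/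
def circuitMatrix {Q : Type} [Fintype Q] [DecidableEq Q] :
    List (Gate Q) → Matrix (Q → Fin 2) (Q → Fin 2) ℂ
  | [] => 1
  | g :: gs => circuitMatrix gs * g.matrix

/-- The output vector `U |0…0⟩` of a circuit. -/
def outputVector {Q : Type} [Fintype Q] [DecidableEq Q] (circ : List (Gate Q)) :
    (Q → Fin 2) → ℂ :=
  circuitMatrix circ *ᵥ Pi.single 0 1

/-- The fidelity `⟨ψ|ρ|ψ⟩`. -/
def fidelity {d : Type} [Fintype d] (ψ : d → ℂ) (ρ : State d) : ℝ :=
  (star ψ ⬝ᵥ (ρ.mat *ᵥ ψ)).re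

/-! ### Cutting the circuit -/

/-- Whether a gate is a `CZ` gate between a qubit in `A` and a qubit outside `A`. -/
def Gate.crosses {Q : Type} [DecidableEq Q] (A : Finset Q) : Gate Q → Bool
  | .single _ _ => false
  | .cz c t _ => decide (¬ (c ∈ A ↔ t ∈ A))

/-- The number of `CZ` gates of the circuit across the cut `A : Aᶜ`. -/
def cutSize {Q : Type} [DecidableEq Q] (A : Finset Q) (circ : List (Gate Q)) : ℕ :=
  circ.countP (Gate.crosses A)

/-- The part of the circuit on the qubits satisfying `P` when the `k`-th `CZ` gate across the cut
is replaced, on its endpoint in `P`, by `Z ^ (i k)`; all other gates with support in `P` are kept,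
and the gates with support outside `P` are dropped.  For `P` the two sides of the cut these are
the operators `V_i` and `W_j` with `U = 2⁻ᴰ ∑ (-1)^(i⬝j) V_i ⊗ W_j`. -/
def branch {Q : Type} [Fintype Q] [DecidableEq Q] (P : Q → Prop) [DecidablePred P] :
    List (Gate Q) → (ℕ → Fin 2) → Matrix ({q // P q} → Fin 2) ({q // P q} → Fin 2) ℂ
  | [], _ => 1
  | .single q u :: gs, i =>
      if h : P q then branch P gs i * onQubit ⟨q, h⟩ (u : Matrix (Fin 2) (Fin 2) ℂ)
      else branch P gs i
  | .cz c t _ :: gs, i =>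
      if hc : P c then
        if ht : P t then branch P gs i * controlledZ ⟨c, hc⟩ ⟨t, ht⟩
        else branch P gs (fun k => i (k + 1)) * onQubit ⟨c, hc⟩ (pauliZ ^ (i 0 : ℕ))
      else
        if ht : P t then
          branch P gs (fun k => i (k + 1)) * onQubit ⟨t, ht⟩ (pauliZ ^ (i 0 : ℕ))
        else branch P gs i

/-- A bit string of length `D`, extended by zeros. -/
def extendBits {D : ℕ} (i : Fin D → Fin 2) : ℕ → Fin 2 :=
  fun k => if h : k < D then i ⟨k, h⟩ else 0

/-! ### The two measurement circuits -/

/-- Three-bit labels `(l₁, l₂, l₃)`. -/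
abbrev Label := Fin 2 × Fin 2 × Fin 2

/-- The Clifford operation `C_l`. -/
def clifford (l : Label) : Matrix (Fin 2) (Fin 2) ℂ :=
  phaseS ^ (if l.1 = 1 ∧ l.2.1 = 0 then 1 else 0) *
    hadamard ^ (if (l.1 : ℕ) + (l.2.1 : ℕ) = 1 then 1 else 0) *
    pauliX ^ (l.2.2 : ℕ)

/-- `|0⟩⟨0| ⊗ I + |1⟩⟨1| ⊗ M`, the ancilla being the first factor. -/
def controlled {κ : Type} [DecidableEq κ] (M : Matrix κ κ ℂ) :
    Matrix (Fin 2 × κ) (Fin 2 × κ) ℂ :=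
  !![1, 0; 0, 0] ⊗ₖ (1 : Matrix κ κ ℂ) + !![0, 0; 0, 1] ⊗ₖ M

/-- The single-qubit operator `u` on the ancilla. -/
def onAncilla {κ : Type} [DecidableEq κ] (u : Matrix (Fin 2) (Fin 2) ℂ) :
    Matrix (Fin 2 × κ) (Fin 2 × κ) ℂ :=
  u ⊗ₖ (1 : Matrix κ κ ℂ)

/-- The first circuit: `C_l† Λ(V'†) X Λ(V†) X H`, the ancilla starting in `|0⟩`. -/
def firstBox {κ : Type} [Fintype κ] [DecidableEq κ] (V V' : Matrix κ κ ℂ) (l : Label) :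
    Matrix (Fin 2 × κ) (Fin 2 × κ) ℂ :=
  onAncilla (clifford l)ᴴ * controlled V'ᴴ * onAncilla pauliX * controlled Vᴴ *
    onAncilla pauliX * onAncilla hadamard

/-- The second circuit: `H Λ(W'†) X Λ(W†) X C_l`, the ancilla starting in `|0⟩`. -/
def secondBox {κ : Type} [Fintype κ] [DecidableEq κ] (W W' : Matrix κ κ ℂ) (l : Label) :
    Matrix (Fin 2 × κ) (Fin 2 × κ) ℂ :=
  onAncilla hadamard * controlled W'ᴴ * onAncilla pauliX * controlled Wᴴ *
    onAncilla pauliX * onAncilla (clifford l)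

/-- An operator on an ancilla and the qubits `S`, carried out on a device with `N` qubits.  The
embedding `π` says which device qubit plays which role (`none` is the ancilla); the operator is
trivial on the device qubits that are not used. -/
def onDevice {S : Type} [Fintype S] {N : ℕ} (π : Option S ↪ Fin N)
    (M : Matrix (Fin 2 × (S → Fin 2)) (Fin 2 × (S → Fin 2)) ℂ) :
    Matrix (Fin N → Fin 2) (Fin N → Fin 2) ℂ :=
  fun x y =>
    if ∀ p, (∀ o, π o ≠ p) → x p = y p then
      M (x (π none), fun s => x (π (some s))) (y (π none), fun s => y (π (some s)))
    else 0

/-- The ideal gate of the first run, on the qubits in `A` and an ancilla. -/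
def idealFirst {Q : Type} [Fintype Q] [DecidableEq Q] {N D : ℕ} (A : Finset Q)
    (circ : List (Gate Q)) (π : Option {q // q ∈ A} ↪ Fin N) (i i' : Fin D → Fin 2) (l : Label) :
    Matrix (Fin N → Fin 2) (Fin N → Fin 2) ℂ :=
  onDevice π (firstBox (branch (fun q => q ∈ A) circ (extendBits i))
    (branch (fun q => q ∈ A) circ (extendBits i')) l)

/-- The ideal gate of the second run, on the qubits outside `A` and an ancilla. -/
def idealSecond {Q : Type} [Fintype Q] [DecidableEq Q] {N D : ℕ} (A : Finset Q)
    (circ : List (Gate Q)) (π : Option {q // q ∉ A} ↪ Fin N) (j j' : Fin D → Fin 2) (l : Label) :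
    Matrix (Fin N → Fin 2) (Fin N → Fin 2) ℂ :=
  onDevice π (secondBox (branch (fun q => q ∉ A) circ (extendBits j))
    (branch (fun q => q ∉ A) circ (extendBits j')) l)

/-! ### Running the circuits -/

/-- Basis states of the two device registers: the qubits of the state sit at the places given by
`π₁` and `π₂`, and every other device qubit (the ancillas among them) is `0`. -/
def loadBits {Q : Type} {N : ℕ} {A : Finset Q} (π₁ : Option {q // q ∈ A} ↪ Fin N)
    (π₂ : Option {q // q ∉ A} ↪ Fin N) (z : Q → Fin 2) : (Fin N → Fin 2) × (Fin N → Fin 2) :=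
  (Function.extend π₁ (fun o => o.elim 0 fun q => z q) 0,
   Function.extend π₂ (fun o => o.elim 0 fun q => z q) 0)

/-- The bits at the places of the qubits of the state. -/
def readBits {Q : Type} [DecidableEq Q] {N : ℕ} {A : Finset Q}
    (π₁ : Option {q // q ∈ A} ↪ Fin N) (π₂ : Option {q // q ∉ A} ↪ Fin N)
    (x : (Fin N → Fin 2) × (Fin N → Fin 2)) : Q → Fin 2 :=
  fun q => if h : q ∈ A then x.1 (π₁ (some ⟨q, h⟩)) else x.2 (π₂ (some ⟨q, h⟩))

theorem readBits_loadBits {Q : Type} [DecidableEq Q] {N : ℕ} {A : Finset Q}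
    (π₁ : Option {q // q ∈ A} ↪ Fin N) (π₂ : Option {q // q ∉ A} ↪ Fin N) (z : Q → Fin 2) :
    readBits π₁ π₂ (loadBits π₁ π₂ z) = z := by
  funext q
  by_cases h : q ∈ A
  · simp [readBits, loadBits, h, π₁.injective.extend_apply]
  · simp [readBits, loadBits, h, π₂.injective.extend_apply]

/-- The isometry that places the qubits of the state into the two device registers. -/
def loadMatrix {Q : Type} {N : ℕ} {A : Finset Q} (π₁ : Option {q // q ∈ A} ↪ Fin N)
    (π₂ : Option {q // q ∉ A} ↪ Fin N) :
    Matrix ((Fin N → Fin 2) × (Fin N → Fin 2)) (Q → Fin 2) ℂ :=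
  fun x z => if x = loadBits π₁ π₂ z then 1 else 0

/-- The input of a run: one copy of `ρ`, with all further device qubits in `|0⟩`. -/
def State.load {Q : Type} [Fintype Q] [DecidableEq Q] {N : ℕ} {A : Finset Q}
    (ρ : State (Q → Fin 2)) (π₁ : Option {q // q ∈ A} ↪ Fin N)
    (π₂ : Option {q // q ∉ A} ↪ Fin N) : State ((Fin N → Fin 2) × (Fin N → Fin 2)) where
  mat := loadMatrix π₁ π₂ * ρ.mat * (loadMatrix π₁ π₂)ᴴ
  posSemidef := ρ.posSemidef.mul_mul_conjTranspose_same _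
  trace_one := by
    have hinj : Function.Injective (loadBits π₁ π₂) :=
      Function.LeftInverse.injective (readBits_loadBits π₁ π₂)
    have hiso : (loadMatrix π₁ π₂)ᴴ * loadMatrix π₁ π₂ = 1 := by
      ext y z
      simp only [Matrix.mul_apply, Matrix.conjTranspose_apply, loadMatrix, Matrix.one_apply]
      simp [hinj.eq_iff, eq_comm]
    rw [Matrix.trace_mul_comm, ← Matrix.mul_assoc, hiso, Matrix.one_mul, ρ.trace_one]

/-- The integer `∑ i_k j_k`, whose parity is the inner product of the bit strings. -/
def dotBits {ι : Type} [Fintype ι] (i j : ι → Fin 2) : ℕ := ∑ k, (i k : ℕ) * (j k : ℕ)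

/-- The `±1`-valued quantity computed from the outcomes of a run: the sign is that of
`z⬝k + i⬝j + i'⬝j' + b`, and also of `o` unless `l₁ = l₂ = 0`, where `o` and `b` are the outcomes
of the ancillas of the first and of the second run. -/
def betaValue {Q : Type} [Fintype Q] [DecidableEq Q] {N D : ℕ} {A : Finset Q}
    (π₁ : Option {q // q ∈ A} ↪ Fin N) (π₂ : Option {q // q ∉ A} ↪ Fin N)
    (k : Q → Fin 2) (i j i' j' : Fin D → Fin 2) (l : Label)
    (x : (Fin N → Fin 2) × (Fin N → Fin 2)) : ℝ :=
  (-1) ^ ((1 + if l.1 = 0 ∧ l.2.1 = 0 then 1 else 0) * (x.1 (π₁ none) : ℕ)) *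
    (-1) ^ (dotBits (readBits π₁ π₂ x) k + dotBits i j + dotBits i' j' + (x.2 (π₂ none) : ℕ))

/-! ### The algorithm

An experiment is a distribution on pairs (real result, number of copies of the state consumed). -/

/-- The sum of the results of independent experiments, the numbers of copies being added too. -/
def indepSum : List (PMF (ℝ × ℕ)) → PMF (ℝ × ℕ)
  | [] => PMF.pure 0
  | p :: ps => p.bind fun a => (indepSum ps).map fun b => a + b

/-- Multiply the result of an experiment by `c`. -/
def scaleResult (c : ℝ) (p : PMF (ℝ × ℕ)) : PMF (ℝ × ℕ) := p.map fun a => (c * a.1, a.2)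

/-- The average of the results of `T` independent repetitions of an experiment. -/
def meanOf (T : ℕ) (p : PMF (ℝ × ℕ)) : PMF (ℝ × ℕ) :=
  scaleResult (1 / T) (indepSum (List.replicate T p))

/-- One run of the two circuits with the actual operations `E₁` and `E₂`, followed by the
computational-basis measurement of the two registers; it consumes one copy of `ρ`. -/
def runOnce {Q : Type} [Fintype Q] [DecidableEq Q] {N D : ℕ} {A : Finset Q}
    (π₁ : Option {q // q ∈ A} ↪ Fin N) (π₂ : Option {q // q ∉ A} ↪ Fin N)
    (E₁ E₂ : (Fin D → Fin 2) → (Fin D → Fin 2) → Label → Channel (Fin N → Fin 2))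
    (ρ : State (Q → Fin 2)) (k : Q → Fin 2) (i j i' j' : Fin D → Fin 2) (l : Label) :
    PMF (ℝ × ℕ) :=
  ((ρ.load π₁ π₂).applyTensor (E₁ i i' l) (E₂ j j' l)).measure.map fun x =>
    (betaValue π₁ π₂ k i j i' j' l x, 1)

/-- The innermost step: half the sum over all labels `l` of the mean over `T₃` runs. -/
def estimateTerm {Q : Type} [Fintype Q] [DecidableEq Q] {N D : ℕ} {A : Finset Q}
    (π₁ : Option {q // q ∈ A} ↪ Fin N) (π₂ : Option {q // q ∉ A} ↪ Fin N)
    (E₁ E₂ : (Fin D → Fin 2) → (Fin D → Fin 2) → Label → Channel (Fin N → Fin 2))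
    (ρ : State (Q → Fin 2)) (T₃ : ℕ) (k : Q → Fin 2) (i j i' j' : Fin D → Fin 2) :
    PMF (ℝ × ℕ) :=
  scaleResult (1 / 2) (indepSum ((Finset.univ : Finset Label).toList.map fun l =>
    meanOf T₃ (runOnce π₁ π₂ E₁ E₂ ρ k i j i' j' l)))

/-- The middle step for a given `k`: `4ᴰ` times the average over `T₂` uniformly random quadruples
`(i, j, i', j')` of the estimates of the innermost step. -/
def estimateStabilizer {Q : Type} [Fintype Q] [DecidableEq Q] {N D : ℕ} {A : Finset Q}
    (π₁ : Option {q // q ∈ A} ↪ Fin N) (π₂ : Option {q // q ∉ A} ↪ Fin N)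
    (E₁ E₂ : (Fin D → Fin 2) → (Fin D → Fin 2) → Label → Channel (Fin N → Fin 2))
    (ρ : State (Q → Fin 2)) (T₂ T₃ : ℕ) (k : Q → Fin 2) : PMF (ℝ × ℕ) :=
  scaleResult (4 ^ D) (meanOf T₂
    ((PMF.uniformOfFintype
      ((Fin D → Fin 2) × (Fin D → Fin 2) × (Fin D → Fin 2) × (Fin D → Fin 2))).bind fun a =>
        estimateTerm π₁ π₂ E₁ E₂ ρ T₃ k a.1 a.2.1 a.2.2.1 a.2.2.2))

/-- The joint distribution of the output `F_est` of the divide-and-conquer algorithm and of the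
number of copies of `ρ` that it consumes: the average over `T₁` uniformly random `k` of the
estimates of the middle step. -/
def divideAndConquer {Q : Type} [Fintype Q] [DecidableEq Q] {N D : ℕ} {A : Finset Q}
    (π₁ : Option {q // q ∈ A} ↪ Fin N) (π₂ : Option {q // q ∉ A} ↪ Fin N)
    (E₁ E₂ : (Fin D → Fin 2) → (Fin D → Fin 2) → Label → Channel (Fin N → Fin 2))
    (ρ : State (Q → Fin 2)) (T₁ T₂ T₃ : ℕ) : PMF (ℝ × ℕ) :=
  meanOf T₁ ((PMF.uniformOfFintype (Q → Fin 2)).bind fun k =>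
    estimateStabilizer π₁ π₂ E₁ E₂ ρ T₂ T₃ k)

end

end DivideConquer

/-!
The output of the algorithm is an average of `T` independent copies of one random variable, namely
`estimateStabilizer` for a uniformly random `k`. That variable lies in `[-4^(D+1), 4^(D+1)]`, so
Hoeffding's inequality over the outermost average alone (`IsExperiment.hoeffding`) gives deviation
at most `ε / 2` with probability `1 - δ` as soon as `T` is of order `16^D ε⁻² log (2 / δ)`; the
inner averages need no concentration, only their means. All of this is done for probability mass
functions directly, through the predicate `IsExperiment`, which records a bound, a number of copies
and a mean, and is preserved by each construction of the algorithm.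

It remains to see that the mean is within `ε / 2` of the fidelity.

*Ideal operations.* In the Heisenberg picture a run measures a tensor product of two observables.
After the first box the ancilla observable is `C_l s_l C_l†` and before the second box the ancilla
state is `C_l |0⟩⟨0| C_l†`; summed over all `l` these give `I⊗I + X⊗X + Y⊗Y + Z⊗Z = 2 SWAP`
(`sum_clifford`), so that the second ancilla takes over the role of the first. What is left is
`V_i Z^k V_{i'}† ⊗ W_j Z^k W_{j'}†`, symmetrized in the two pairs of labels (`sum_label_ideal`).
Since `CZ = ½ ∑ (-1)^(ab) Z^a ⊗ Z^b`, the circuit is `2⁻ᴰ ∑ (-1)^(i⬝j) V_i ⊗ W_j`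
(`circuitMatrix_eq_sum`), hence the sum over all quadruples is `4^D U Z^k U†` (`sum_quadTerm`), and
the average of `Z^k` over `k` is the projection onto `|0…0⟩` (`sum_trace_zString`).

*Actual operations.* A channel within diamond distance `η` of an isometry changes the expectation
of a diagonal `±1` observable by at most `η` (`abs_expectation_sub_le`). With `η = ε / 4^(D+2)`, two
channels in each run, half a sum over eight labels and the prefactor `4^D`, the total bias is at
most `ε / 2` (`abs_algorithmMean_sub_le`).
-/

namespace DivideConquer

/-! ### Means of bounded experiments -/

/-- The experiment `p` has results in `[-R, R]` with mean `μ` and consumes exactly `N` copies of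
the state. -/
structure IsExperiment (p : PMF (ℝ × ℕ)) (R : ℝ) (N : ℕ) (μ : ℝ) : Prop where
  bounded : ∀ a ∈ p.support, |a.1| ≤ R
  copies : ∀ a ∈ p.support, a.2 = N
  hasSum : HasSum (fun a => (p a).toReal * a.1) μ

theorem hasSum_toReal {α : Type*} (p : PMF α) : HasSum (fun a => (p a).toReal) 1 := by
  have h := ENNReal.hasSum_toReal (f := p) p.tsum_coe_ne_top
  rwa [← ENNReal.tsum_toReal_eq p.apply_ne_top, p.tsum_coe, ENNReal.toReal_one] at h

theorem IsExperiment.bind {α : Type*} {p : PMF α} {q : α → PMF (ℝ × ℕ)} {R : ℝ} {N : ℕ}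
    {m : α → ℝ} {μ : ℝ} (hq : ∀ a ∈ p.support, IsExperiment (q a) R N (m a))
    (hμ : HasSum (fun a => (p a).toReal * m a) μ) : IsExperiment (p.bind q) R N μ := by
  refine ⟨fun b hb => ?_, fun b hb => ?_, ?_⟩
  · obtain ⟨a, ha, hb⟩ := (PMF.mem_support_bind_iff _ _ _).1 hb
    exact (hq a ha).bounded b hb
  · obtain ⟨a, ha, hb⟩ := (PMF.mem_support_bind_iff _ _ _).1 hb
    exact (hq a ha).copies b hb
  have hw : Summable fun x : α × (ℝ × ℕ) => (p x.1).toReal * (q x.1 x.2).toReal := by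
    have h0 : 0 ≤ fun x : α × (ℝ × ℕ) => (p x.1).toReal * (q x.1 x.2).toReal := fun x => by
      simp only [Pi.zero_apply]
      positivity
    refine (summable_prod_of_nonneg h0).2 ⟨fun a =>
      (hasSum_toReal (q a)).summable.mul_left (p a).toReal, ?_⟩
    refine (hasSum_toReal p).summable.congr fun a => ?_
    rw [((hasSum_toReal (q a)).mul_left (p a).toReal).tsum_eq, mul_one]
  have hs : Summable fun x : α × (ℝ × ℕ) => (p x.1).toReal * (q x.1 x.2).toReal * x.2.1 := by
    refine Summable.of_norm_bounded (hw.mul_right R) fun x => ?_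
    rw [norm_mul, Real.norm_of_nonneg (by positivity)]
    by_cases hp : p x.1 = 0
    · simp [hp]
    by_cases hx : q x.1 x.2 = 0
    · simp [hx]
    exact mul_le_mul_of_nonneg_left ((hq x.1 ((PMF.mem_support_iff _ _).2 hp)).bounded x.2
      ((PMF.mem_support_iff _ _).2 hx)) (by positivity)
  obtain ⟨s, hs⟩ := hs
  have h1 : HasSum (fun a => (p a).toReal * m a) s := by
    refine hs.prod_fiberwise fun a => ?_
    by_cases hp : p a = 0
    · simp [hp, hasSum_zero]
    simpa [mul_assoc] using
      (hq a ((PMF.mem_support_iff _ _).2 hp)).hasSum.mul_left (p a).toReal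
  rw [hμ.unique h1]
  refine ((Equiv.prodComm _ _).hasSum_iff.2 hs).prod_fiberwise fun b => ?_
  refine HasSum.mul_right b.1 ?_
  rw [PMF.bind_apply]
  have hb : ∑' a, p a * q a b ≠ ∞ := by
    rw [← PMF.bind_apply]
    exact PMF.apply_ne_top _ _
  rw [ENNReal.tsum_toReal_eq (ENNReal.ne_top_of_tsum_ne_top hb)]
  simpa using ENNReal.hasSum_toReal hb

theorem IsExperiment.pure (a : ℝ × ℕ) {R : ℝ} (h : |a.1| ≤ R) :
    IsExperiment (PMF.pure a) R a.2 a.1 := by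
  refine ⟨by simpa using h, by simp, ?_⟩
  convert hasSum_single a fun b hb => ?_
  · simp
  · simp [hb]

theorem IsExperiment.map_of_hasSum {α : Type*} {p : PMF α} {f : α → ℝ × ℕ} {R : ℝ} {N : ℕ} {μ : ℝ}
    (hR : ∀ a ∈ p.support, |(f a).1| ≤ R) (hN : ∀ a ∈ p.support, (f a).2 = N)
    (hμ : HasSum (fun a => (p a).toReal * (f a).1) μ) : IsExperiment (p.map f) R N μ :=
  IsExperiment.bind (fun a ha => hN a ha ▸ IsExperiment.pure (f a) (hR a ha)) hμ

theorem IsExperiment.scale {p : PMF (ℝ × ℕ)} {R : ℝ} {N : ℕ} {μ c : ℝ} (hc : 0 ≤ c)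
    (hp : IsExperiment p R N μ) : IsExperiment (scaleResult c p) (c * R) N (c * μ) := by
  refine IsExperiment.map_of_hasSum (fun a ha => ?_) hp.copies ?_
  · rw [abs_mul, abs_of_nonneg hc]
    exact mul_le_mul_of_nonneg_left (hp.bounded a ha) hc
  · simpa [mul_left_comm] using hp.hasSum.mul_left c

theorem IsExperiment.indepSum_cons {p : PMF (ℝ × ℕ)} {ps : List (PMF (ℝ × ℕ))} {R R' : ℝ}
    {N N' : ℕ} {μ μ' : ℝ} (hp : IsExperiment p R N μ) (hps : IsExperiment (indepSum ps) R' N' μ') :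
    IsExperiment (indepSum (p :: ps)) (R + R') (N + N') (μ + μ') := by
  refine IsExperiment.bind (m := fun a => a.1 + μ') (fun a ha => ?_) ?_
  · refine IsExperiment.map_of_hasSum (fun b hb => ?_) (fun b hb => ?_) ?_
    · exact (abs_add_le _ _).trans (add_le_add (hp.bounded a ha) (hps.bounded b hb))
    · simp [hp.copies a ha, hps.copies b hb]
    · simpa [mul_add] using ((hasSum_toReal (indepSum ps)).mul_right a.1).add hps.hasSum
  · simpa [mul_add] using hp.hasSum.add ((hasSum_toReal p).mul_right μ')

theorem IsExperiment.indepSum_map {ι : Type*} (s : List ι) {p : ι → PMF (ℝ × ℕ)} {R : ℝ}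
    {N : ℕ} {μ : ι → ℝ} (h : ∀ i, IsExperiment (p i) R N (μ i)) :
    IsExperiment (indepSum (s.map p)) (s.length * R) (s.length * N) (s.map μ).sum := by
  induction s with
  | nil => simpa [indepSum] using IsExperiment.pure (0 : ℝ × ℕ) (R := 0) (by simp)
  | cons i s ih =>
    have := (h i).indepSum_cons ih
    simpa [add_mul, add_comm] using this

theorem IsExperiment.meanOf {p : PMF (ℝ × ℕ)} {R : ℝ} {N : ℕ} {μ : ℝ} {T : ℕ} (hT : 1 ≤ T)
    (hp : IsExperiment p R N μ) : IsExperiment (meanOf T p) R (T * N) μ := by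
  have h := (IsExperiment.indepSum_map (List.replicate T ()) fun _ => hp).scale
    (c := 1 / T) (by positivity)
  have hT' : (T : ℝ) ≠ 0 := by positivity
  simpa [DivideConquer.meanOf, hT'] using h

theorem IsExperiment.uniform_bind {α : Type*} [Fintype α] [Nonempty α] {q : α → PMF (ℝ × ℕ)}
    {R : ℝ} {N : ℕ} {m : α → ℝ} (hq : ∀ a, IsExperiment (q a) R N (m a)) :
    IsExperiment ((PMF.uniformOfFintype α).bind q) R N
      ((Fintype.card α : ℝ)⁻¹ * ∑ a, m a) := by
  refine IsExperiment.bind (fun a _ => hq a) ?_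
  rw [Finset.mul_sum]
  simpa using hasSum_fintype fun a => (Fintype.card α : ℝ)⁻¹ * m a

/-! ### Hoeffding's inequality -/

theorem tsum_bind_mul {α β : Type*} (p : PMF α) (q : α → PMF β) (f : β → ℝ≥0∞) :
    ∑' b, p.bind q b * f b = ∑' a, p a * ∑' b, q a b * f b := by
  simp_rw [PMF.bind_apply, ← ENNReal.tsum_mul_right, ← ENNReal.tsum_mul_left]
  rw [ENNReal.tsum_comm]
  simp_rw [mul_assoc]

theorem tsum_pure_mul {α : Type*} (a : α) (f : α → ℝ≥0∞) : ∑' b, PMF.pure a b * f b = f a := by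
  rw [tsum_eq_single a fun b hb => by simp [hb]]
  simp

theorem tsum_map_mul {α β : Type*} (p : PMF α) (g : α → β) (f : β → ℝ≥0∞) :
    ∑' b, p.map g b * f b = ∑' a, p a * f (g a) := by
  simp_rw [PMF.map, tsum_bind_mul, Function.comp_apply, tsum_pure_mul]

/-- Moment generating functions of independent sums multiply. -/
theorem tsum_indepSum_replicate (p : PMF (ℝ × ℕ)) (s μ : ℝ) (T : ℕ) :
    ∑' b, indepSum (List.replicate T p) b * ENNReal.ofReal (Real.exp (s * (b.1 - T * μ))) =
      (∑' a, p a * ENNReal.ofReal (Real.exp (s * (a.1 - μ)))) ^ T := by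
  induction T with
  | zero =>
    rw [List.replicate_zero, indepSum, tsum_pure_mul]
    simp
  | succ T ih =>
    rw [List.replicate_succ, indepSum, tsum_bind_mul, pow_succ', ← ih, ← ENNReal.tsum_mul_right]
    refine tsum_congr fun a => ?_
    rw [tsum_map_mul, mul_assoc]
    congr 1
    rw [← ENNReal.tsum_mul_left]
    refine tsum_congr fun b => ?_
    rw [mul_left_comm, ← ENNReal.ofReal_mul (Real.exp_nonneg _), ← Real.exp_add]
    congr 4
    simp only [Prod.fst_add, Nat.cast_add, Nat.cast_one]
    ring

/-- The graph of `x ↦ exp (s * x)` on `[-c, c]` lies below its chord. -/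
theorem exp_mul_le_chord {c x : ℝ} (hc : 0 < c) (hx : |x| ≤ c) (s : ℝ) :
    Real.exp (s * x) ≤ Real.cosh (s * c) + x / c * Real.sinh (s * c) := by
  obtain ⟨h1, h2⟩ := abs_le.1 hx
  have ha : 0 ≤ (c + x) / (2 * c) := div_nonneg (by linarith) (by linarith)
  have hb : 0 ≤ (c - x) / (2 * c) := div_nonneg (by linarith) (by linarith)
  have h := convexOn_exp.2 (Set.mem_univ (s * c)) (Set.mem_univ (-(s * c))) ha hb
    (by field_simp; ring)
  simp only [smul_eq_mul] at h
  rw [Real.cosh_eq, Real.sinh_eq]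
  have h1 : (c + x) / (2 * c) * (s * c) + (c - x) / (2 * c) * -(s * c) = s * x := by
    field_simp
    ring
  rw [h1] at h
  refine h.trans_eq ?_
  field_simp
  ring

/-- Hoeffding's lemma, with the cruder bound that the centred result lies in `[-2R, 2R]`. -/
theorem IsExperiment.mgf_le {p : PMF (ℝ × ℕ)} {R : ℝ} {N : ℕ} {μ : ℝ} (hR : 0 < R)
    (hp : IsExperiment p R N μ) (hμ : |μ| ≤ R) (s : ℝ) :
    ∑' a, p a * ENNReal.ofReal (Real.exp (s * (a.1 - μ))) ≤
      ENNReal.ofReal (Real.exp (2 * R ^ 2 * s ^ 2)) := by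
  set g : ℝ × ℕ → ℝ := fun a => (p a).toReal *
    (Real.cosh (s * (2 * R)) + (a.1 - μ) / (2 * R) * Real.sinh (s * (2 * R))) with hg
  have hle : ∀ a, (p a).toReal * Real.exp (s * (a.1 - μ)) ≤ g a := by
    intro a
    by_cases ha : p a = 0
    · simp [hg, ha]
    refine mul_le_mul_of_nonneg_left (exp_mul_le_chord (by linarith) ?_ s) (by positivity)
    have h1 := abs_le.1 (hp.bounded a ((PMF.mem_support_iff _ _).2 ha))
    have h2 := abs_le.1 hμ
    exact abs_le.2 ⟨by linarith, by linarith⟩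
  have hsum : HasSum g (Real.cosh (s * (2 * R))) := by
    have h1 := (hasSum_toReal p).mul_right (Real.cosh (s * (2 * R)))
    have h2 := (hp.hasSum.sub ((hasSum_toReal p).mul_right μ)).mul_right
      ((2 * R)⁻¹ * Real.sinh (s * (2 * R)))
    rw [one_mul] at h1
    rw [one_mul, sub_self, zero_mul] at h2
    have h3 := h1.add h2
    rw [add_zero] at h3
    refine h3.congr_fun fun a => ?_
    simp only [hg]
    ring
  calc ∑' a, p a * ENNReal.ofReal (Real.exp (s * (a.1 - μ)))
      = ∑' a, ENNReal.ofReal ((p a).toReal * Real.exp (s * (a.1 - μ))) := by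
        refine tsum_congr fun a => ?_
        rw [ENNReal.ofReal_mul ENNReal.toReal_nonneg, ENNReal.ofReal_toReal (p.apply_ne_top a)]
    _ ≤ ∑' a, ENNReal.ofReal (g a) :=
        ENNReal.tsum_le_tsum fun a => ENNReal.ofReal_le_ofReal (hle a)
    _ = ENNReal.ofReal (Real.cosh (s * (2 * R))) := by
        rw [← ENNReal.ofReal_tsum_of_nonneg (fun a => le_trans (by positivity) (hle a))
          hsum.summable, hsum.tsum_eq]
    _ ≤ _ := by
        refine ENNReal.ofReal_le_ofReal ((Real.cosh_le_exp_half_sq _).trans_eq ?_)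
        congr 1; ring

theorem IsExperiment.abs_mean_le {p : PMF (ℝ × ℕ)} {R : ℝ} {N : ℕ} {μ : ℝ}
    (hp : IsExperiment p R N μ) : |μ| ≤ R := by
  have h1 := (hasSum_toReal p).mul_right R
  rw [one_mul] at h1
  have key : ∀ a, |(p a).toReal * a.1| ≤ (p a).toReal * R := by
    intro a
    by_cases ha : p a = 0
    · simp [ha]
    rw [abs_mul, abs_of_nonneg ENNReal.toReal_nonneg]
    exact mul_le_mul_of_nonneg_left (hp.bounded a ((PMF.mem_support_iff _ _).2 ha))
      ENNReal.toReal_nonneg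
  refine abs_le.2 ⟨hasSum_le (fun a => (abs_le.1 (key a)).1) h1.neg hp.hasSum,
    hasSum_le (fun a => (abs_le.1 (key a)).2) hp.hasSum h1⟩

/-- The one-sided Chernoff bound for an average; the sign `σ` selects the tail. -/
theorem IsExperiment.tail_le {p : PMF (ℝ × ℕ)} {R : ℝ} {N : ℕ} {μ t σ : ℝ} {T : ℕ} (hR : 0 < R)
    (hT : 1 ≤ T) (ht : 0 ≤ t) (hp : IsExperiment p R N μ) (hσ : σ ^ 2 = 1) :
    (DivideConquer.meanOf T p).toOuterMeasure {a | t < σ * (a.1 - μ)} ≤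
      ENNReal.ofReal (Real.exp (-(T * t ^ 2 / (8 * R ^ 2)))) := by
  have hT' : (T : ℝ) ≠ 0 := by positivity
  set s : ℝ := t / (4 * R ^ 2) with hs
  have hs0 : 0 ≤ s := by positivity
  calc (DivideConquer.meanOf T p).toOuterMeasure {a | t < σ * (a.1 - μ)}
      ≤ ∑' a, DivideConquer.meanOf T p a *
          ENNReal.ofReal (Real.exp (T * s * (σ * (a.1 - μ) - t))) := by
        rw [PMF.toOuterMeasure_apply]
        refine ENNReal.tsum_le_tsum fun a => ?_
        by_cases ha : t < σ * (a.1 - μ)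
        · rw [Set.indicator_of_mem (by exact ha)]
          refine le_mul_of_one_le_right' ?_
          rw [ENNReal.one_le_ofReal, Real.one_le_exp_iff]
          exact mul_nonneg (by positivity) (by linarith)
        · rw [Set.indicator_of_notMem (by exact ha)]
          exact zero_le
    _ = ENNReal.ofReal (Real.exp (-(T * s * t))) *
          (∑' a, p a * ENNReal.ofReal (Real.exp (s * σ * (a.1 - μ)))) ^ T := by
        rw [DivideConquer.meanOf, scaleResult, tsum_map_mul, ← tsum_indepSum_replicate,
          ← ENNReal.tsum_mul_left]
        refine tsum_congr fun b => ?_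
        rw [mul_left_comm, ← ENNReal.ofReal_mul (Real.exp_nonneg _), ← Real.exp_add]
        congr 3
        field_simp
        ring
    _ ≤ ENNReal.ofReal (Real.exp (-(T * s * t))) *
          ENNReal.ofReal (Real.exp (2 * R ^ 2 * (s * σ) ^ 2)) ^ T := by
        gcongr
        exact hp.mgf_le hR hp.abs_mean_le _
    _ = _ := by
        rw [← ENNReal.ofReal_pow (Real.exp_nonneg _), ← Real.exp_nat_mul,
          ← ENNReal.ofReal_mul (Real.exp_nonneg _), ← Real.exp_add, mul_pow, hσ, hs]
        congr 2
        field_simp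
        ring

/-- Hoeffding's inequality for the average of `T` independent repetitions. -/
theorem IsExperiment.hoeffding {p : PMF (ℝ × ℕ)} {R : ℝ} {N : ℕ} {μ t δ : ℝ} {T : ℕ} (hR : 0 < R)
    (hT : 1 ≤ T) (ht : 0 ≤ t) (hp : IsExperiment p R N μ)
    (hδ : 2 * Real.exp (-(T * t ^ 2 / (8 * R ^ 2))) ≤ δ) :
    ENNReal.ofReal (1 - δ) ≤
      (DivideConquer.meanOf T p).toOuterMeasure {a | |a.1 - μ| ≤ t} := by
  set P := (DivideConquer.meanOf T p).toOuterMeasure with hP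
  have h1 := hp.tail_le (t := t) (σ := 1) hR hT ht (by norm_num)
  have h2 := hp.tail_le (t := t) (σ := -1) hR hT ht (by norm_num)
  have huniv : P Set.univ = 1 := by
    rw [hP, PMF.toOuterMeasure_apply]
    simp [PMF.tsum_coe]
  have hcov : (Set.univ : Set (ℝ × ℕ)) ⊆ {a | |a.1 - μ| ≤ t} ∪
      ({a | t < 1 * (a.1 - μ)} ∪ {a | t < -1 * (a.1 - μ)}) := by
    intro a _
    by_cases ha : |a.1 - μ| ≤ t
    · exact Or.inl ha
    · rw [not_le, lt_abs] at ha
      simpa using Or.inr ha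
  have h : 1 ≤ P {a | |a.1 - μ| ≤ t} + ENNReal.ofReal δ := by
    calc 1 = P Set.univ := huniv.symm
      _ ≤ P {a | |a.1 - μ| ≤ t} + (P {a | t < 1 * (a.1 - μ)} + P {a | t < -1 * (a.1 - μ)}) :=
          (P.mono hcov).trans ((MeasureTheory.measure_union_le _ _).trans
            (add_le_add_right (MeasureTheory.measure_union_le _ _) _))
      _ ≤ _ := by
          refine add_le_add_right ((add_le_add h1 h2).trans ?_) _
          rw [← ENNReal.ofReal_add (Real.exp_nonneg _) (Real.exp_nonneg _)]
          exact ENNReal.ofReal_le_ofReal (by linarith)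
  rw [ENNReal.ofReal_sub _ (le_trans (by positivity) hδ), ENNReal.ofReal_one]
  exact tsub_le_iff_right.2 h

/-! ### The trace norm and the diamond norm -/

section TraceNorm

variable {d κ : Type} [Fintype d] [DecidableEq d] [Fintype κ] [DecidableEq κ]

theorem trace_eq_sum_eigenvectors {H : Matrix d d ℂ} (hH : H.IsHermitian) (X : Matrix d d ℂ) :
    X.trace = ∑ s, star (hH.eigenvectorBasis s).ofLp ⬝ᵥ X *ᵥ (hH.eigenvectorBasis s).ofLp := by
  set U : Matrix d d ℂ := ↑hH.eigenvectorUnitary with hU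
  have hUU : U * Uᴴ = 1 := Matrix.mem_unitaryGroup_iff.1 hH.eigenvectorUnitary.2
  have h : X.trace = (Uᴴ * (X * U)).trace := by
    rw [Matrix.trace_mul_comm, Matrix.mul_assoc, hUU, Matrix.mul_one]
  rw [h]
  simp [Matrix.trace, Matrix.mul_apply, dotProduct, Matrix.mulVec, hU,
    Matrix.IsHermitian.eigenvectorUnitary_apply]

omit [DecidableEq d] in
theorem sum_norm_sq_eq (v : d → ℂ) : ((∑ x, ‖v x‖ ^ 2 : ℝ) : ℂ) = star v ⬝ᵥ v := by
  simp [dotProduct, Complex.conj_mul']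

theorem sum_norm_sq_eigenvectorBasis {H : Matrix d d ℂ} (hH : H.IsHermitian) (s : d) :
    ∑ x, ‖(hH.eigenvectorBasis s).ofLp x‖ ^ 2 = 1 := by
  rw [← EuclideanSpace.norm_sq_eq, hH.eigenvectorBasis.orthonormal.1 s, one_pow]

/-- Duality of the trace norm with diagonal contractions: expand the trace in the eigenvectors of
`Xᴴ * X` and apply the Cauchy–Schwarz inequality to each summand. -/
theorem norm_sum_mul_diag_le_traceNorm (X : Matrix d d ℂ) (c : d → ℂ) (hc : ∀ x, ‖c x‖ ≤ 1) :
    ‖∑ x, c x * X x x‖ ≤ traceNorm X := by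
  have hH := Matrix.isHermitian_conjTranspose_mul_self X
  have ht : ∑ x, c x * X x x = (Matrix.diagonal c * X).trace := by
    simp [Matrix.trace]
  rw [ht, trace_eq_sum_eigenvectors hH, traceNorm]
  refine norm_sum_le_of_le _ fun s _ => ?_
  set v := (hH.eigenvectorBasis s).ofLp with hv
  have hXv : ∑ x, ‖(X *ᵥ v) x‖ ^ 2 = hH.eigenvalues s := by
    have h : star (X *ᵥ v) ⬝ᵥ X *ᵥ v = star v ⬝ᵥ ((Xᴴ * X) *ᵥ v) := by
      rw [Matrix.star_mulVec, ← Matrix.mulVec_mulVec, Matrix.dotProduct_mulVec,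
        Matrix.dotProduct_mulVec, Matrix.dotProduct_mulVec]
    have h1 := sum_norm_sq_eq v
    rw [sum_norm_sq_eigenvectorBasis hH s] at h1
    rw [hv, hH.mulVec_eigenvectorBasis s, ← hv, dotProduct_smul, ← h1, ← sum_norm_sq_eq] at h
    simpa only [Complex.real_smul, mul_one, Complex.ofReal_one, Complex.ofReal_re] using
      congrArg Complex.re h
  calc ‖star v ⬝ᵥ (Matrix.diagonal c * X) *ᵥ v‖
      ≤ ∑ x, ‖v x‖ * ‖(X *ᵥ v) x‖ := by
        rw [← Matrix.mulVec_mulVec, dotProduct]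
        refine norm_sum_le_of_le _ fun x _ => ?_
        rw [Matrix.mulVec_diagonal, norm_mul, norm_mul, Pi.star_apply, norm_star]
        refine mul_le_mul_of_nonneg_left ?_ (norm_nonneg _)
        exact mul_le_of_le_one_left (norm_nonneg _) (hc x)
    _ ≤ √(∑ x, ‖v x‖ ^ 2) * √(∑ x, ‖(X *ᵥ v) x‖ ^ 2) := Real.sum_mul_le_sqrt_mul_sqrt _ _ _
    _ = _ := by rw [hXv, sum_norm_sq_eigenvectorBasis hH s, Real.sqrt_one, one_mul]

/-- If `λ` is an eigenvalue of `Xᴴ * X = X²` with eigenvector `v`, then `w = X v - √λ v` satisfies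
`X w = -√λ w`, which forces `√λ w = 0` since `X` is positive. -/
theorem traceNorm_le_of_posSemidef {X : Matrix d d ℂ} (hX : X.PosSemidef) :
    traceNorm X ≤ X.trace.re := by
  have hH := Matrix.isHermitian_conjTranspose_mul_self X
  rw [trace_eq_sum_eigenvectors hH, Complex.re_sum, traceNorm]
  refine Finset.sum_le_sum fun s _ => ?_
  set v := (hH.eigenvectorBasis s).ofLp with hv
  have h0 : 0 ≤ hH.eigenvalues s :=
    (Matrix.posSemidef_conjTranspose_mul_self X).eigenvalues_nonneg s
  set r := √(hH.eigenvalues s) with hr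
  have hr0 : 0 ≤ r := Real.sqrt_nonneg _
  rcases hr0.eq_or_lt with h | hpos
  · rw [← h]
    exact hX.re_dotProduct_nonneg v
  have hXX : X *ᵥ (X *ᵥ v) = (r : ℂ) • (r : ℂ) • v := by
    have h1 := hH.mulVec_eigenvectorBasis s
    rw [← hv, ← Matrix.mulVec_mulVec] at h1
    conv_lhs at h1 => rw [hX.isHermitian.eq]
    rw [h1, smul_smul, ← Complex.ofReal_mul, hr, Real.mul_self_sqrt h0]
    rfl
  set w := X *ᵥ v - (r : ℂ) • v with hw
  have hXw : X *ᵥ w = -((r : ℂ) • w) := by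
    rw [hw, Matrix.mulVec_sub, hXX, Matrix.mulVec_smul, smul_sub]
    abel
  have hw0 : w = 0 := by
    have h1 := hX.re_dotProduct_nonneg w
    rw [hXw, dotProduct_neg, dotProduct_smul, ← sum_norm_sq_eq] at h1
    have h2 : r * ∑ x, ‖w x‖ ^ 2 ≤ 0 := by
      rw [smul_eq_mul, ← Complex.ofReal_mul, ← Complex.ofReal_neg] at h1
      exact neg_nonneg.1 h1
    have h3 : 0 ≤ ∑ x, ‖w x‖ ^ 2 := Finset.sum_nonneg fun x _ => by positivity
    have h4 : ∑ x, ‖w x‖ ^ 2 = 0 := le_antisymm (by nlinarith) h3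
    funext x
    simpa using (Finset.sum_eq_zero_iff_of_nonneg fun x _ => by positivity).1 h4 x
      (Finset.mem_univ x)
  rw [sub_eq_zero.1 hw0, dotProduct_smul, ← sum_norm_sq_eq, sum_norm_sq_eigenvectorBasis hH s]
  simp

omit [DecidableEq κ] in
/-- A diamond-norm bound controls the expectation of every observable that is diagonal in the
computational basis with values in `[-1, 1]`, with an arbitrary reference system. -/
theorem abs_sum_mul_diag_ampLeft_le {Φ : Matrix d d ℂ →ₗ[ℂ] Matrix d d ℂ} {δ : ℝ} (hδ : 0 ≤ δ)
    (hΦ : diamondNorm Φ ≤ ENNReal.ofReal δ) {X : Matrix (d × κ) (d × κ) ℂ} (hX : X.PosSemidef)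
    (hX1 : X.trace = 1) (c : d × κ → ℝ) (hc : ∀ x, |c x| ≤ 1) :
    |∑ x, c x * (ampLeft Φ X x x).re| ≤ δ := by
  let e := (Equiv.refl d).prodCongr (Fintype.equivFin κ).symm
  set Y := X.submatrix e e with hY
  have hY1 : traceNorm Y ≤ 1 := by
    refine (traceNorm_le_of_posSemidef (hX.submatrix e)).trans_eq ?_
    have : (X.submatrix e e).trace = X.trace := e.sum_comp fun a => X a a
    rw [this, hX1, Complex.one_re]
  have h1 : traceNorm (ampLeft Φ Y) ≤ δ := by
    refine (ENNReal.ofReal_le_ofReal_iff hδ).1 (le_trans ?_ hΦ)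
    exact le_iSup_of_le (Fintype.card κ) (le_iSup_of_le Y (le_iSup_of_le hY1 le_rfl))
  have h2 : ∑ x, ((c (e x) : ℝ) : ℂ) * ampLeft Φ Y x x = ∑ x, (c x : ℂ) * ampLeft Φ X x x :=
    e.sum_comp fun x => (c x : ℂ) * ampLeft Φ X x x
  have h3 := norm_sum_mul_diag_le_traceNorm (ampLeft Φ Y) (fun x => (c (e x) : ℂ))
    fun x => by simpa using hc (e x)
  rw [h2] at h3
  refine le_trans ?_ (h3.trans h1)
  refine le_trans (le_of_eq ?_) (Complex.abs_re_le_norm _)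
  simp

theorem ampLeft_eq_sum (Φ : Matrix d d ℂ →ₗ[ℂ] Matrix d d ℂ) {κ : Type}
    (X : Matrix (d × κ) (d × κ) ℂ) (a b : d × κ) :
    ampLeft Φ X a b = ∑ s, ∑ t, Φ (Matrix.single s t 1) a.1 b.1 * X (s, a.2) (t, b.2) := by
  have h : (fun s t => X (s, a.2) (t, b.2) : Matrix d d ℂ) =
      ∑ s, ∑ t, X (s, a.2) (t, b.2) • Matrix.single s t (1 : ℂ) := by
    simp_rw [Matrix.smul_single, smul_eq_mul, mul_one]
    exact Matrix.matrix_eq_sum_single _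
  rw [ampLeft, h]
  simp only [map_sum, map_smul, Matrix.sum_apply, Matrix.smul_apply, smul_eq_mul, mul_comm]

theorem ampLeft_ampRight_comm (Φ : Matrix d d ℂ →ₗ[ℂ] Matrix d d ℂ)
    (Ψ : Matrix κ κ ℂ →ₗ[ℂ] Matrix κ κ ℂ) (X : Matrix (d × κ) (d × κ) ℂ) :
    ampLeft Φ (ampRight Ψ X) = ampRight Ψ (ampLeft Φ X) := by
  ext a b
  simp only [ampRight, ampLeft_eq_sum, Matrix.submatrix_apply, Prod.fst_swap, Prod.snd_swap,
    Prod.swap_prod_mk, Finset.mul_sum]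
  have h := Finset.sum_comm (s := Finset.univ) (t := Finset.univ)
    (f := fun (p : d × d) (q : κ × κ) => Φ (Matrix.single p.1 p.2 1) a.1 b.1 *
      (Ψ (Matrix.single q.1 q.2 1) a.2 b.2 * X (p.1, q.1) (p.2, q.2)))
  simp only [Fintype.sum_prod_type] at h
  rw [h]
  simp only [mul_left_comm]

omit [DecidableEq d] in
theorem ampLeft_conjMap (V : Matrix d d ℂ) (X : Matrix (d × κ) (d × κ) ℂ) :
    ampLeft (conjMap V) X = (V ⊗ₖ (1 : Matrix κ κ ℂ)) * X * (V ⊗ₖ (1 : Matrix κ κ ℂ))ᴴ := by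
  ext a b
  simp only [ampLeft, conjMap, Matrix.mul_apply, Fintype.sum_prod_type,
    Matrix.kroneckerMap_apply, Matrix.one_apply, Matrix.conjTranspose_apply, LinearMap.coe_mk,
    AddHom.coe_mk]
  simp [apply_ite (starRingEnd ℂ)]
  rfl

omit [DecidableEq d] in
theorem ampRight_conjMap (V : Matrix d d ℂ) (X : Matrix (κ × d) (κ × d) ℂ) :
    ampRight (conjMap V) X = ((1 : Matrix κ κ ℂ) ⊗ₖ V) * X * ((1 : Matrix κ κ ℂ) ⊗ₖ V)ᴴ := by
  ext a b
  simp only [ampRight, ampLeft, conjMap, Matrix.mul_apply, Fintype.sum_prod_type,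
    Matrix.kroneckerMap_apply, Matrix.one_apply, Matrix.conjTranspose_apply, LinearMap.coe_mk,
    AddHom.coe_mk,
    Matrix.submatrix_apply, Prod.swap_prod_mk, Prod.fst_swap, Prod.snd_swap]
  simp [apply_ite (starRingEnd ℂ)]
  rfl

omit [DecidableEq d] [DecidableEq κ] in
theorem posSemidef_ampRight (Φ : Channel κ) {X : Matrix (d × κ) (d × κ) ℂ} (hX : X.PosSemidef) :
    (ampRight Φ.map X).PosSemidef :=
  (Φ.completelyPositive d _ (hX.submatrix _)).submatrix _

omit [DecidableEq d] [DecidableEq κ] in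
theorem trace_ampRight (Φ : Channel κ) (X : Matrix (d × κ) (d × κ) ℂ) :
    (ampRight Φ.map X).trace = X.trace := by
  simp only [Matrix.trace, Matrix.diag, Fintype.sum_prod_type]
  exact Finset.sum_congr rfl fun r _ => Φ.tracePreserving (fun s t => X (r, s) (r, t))

/-- Replacing two channels on the two halves of a state by two isometries changes the expectation
of a diagonal observable with values in `[-1, 1]` by at most the sum of the diamond distances. -/
theorem abs_expectation_sub_le {δ : ℝ} (hδ : 0 ≤ δ) (σ : State (d × κ)) (E : Channel d)
    (F : Channel κ) (V : Matrix d d ℂ) (W : Matrix κ κ ℂ) (hV : Vᴴ * V = 1)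
    (hE : diamondNorm (E.map - conjMap V) ≤ ENNReal.ofReal δ)
    (hF : diamondNorm (F.map - conjMap W) ≤ ENNReal.ofReal δ) (c : d × κ → ℝ)
    (hc : ∀ x, |c x| ≤ 1) :
    |∑ x, c x * ((σ.applyTensor E F).mat x x).re -
      ∑ x, c x * (((V ⊗ₖ W) * σ.mat * (V ⊗ₖ W)ᴴ) x x).re| ≤ 2 * δ := by
  set V1 := V ⊗ₖ (1 : Matrix κ κ ℂ) with hV1
  have hVV : V1ᴴ * V1 = 1 := by
    rw [hV1, Matrix.conjTranspose_kronecker, ← Matrix.mul_kronecker_mul, hV,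
      Matrix.conjTranspose_one, Matrix.one_mul, Matrix.one_kronecker_one]
  have h1 := abs_sum_mul_diag_ampLeft_le hδ hE (posSemidef_ampRight F σ.posSemidef)
    ((trace_ampRight F σ.mat).trans σ.trace_one) c hc
  have hp : (ampLeft (conjMap V) σ.mat).PosSemidef := by
    rw [ampLeft_conjMap]
    exact σ.posSemidef.mul_mul_conjTranspose_same _
  have ht : (ampLeft (conjMap V) σ.mat).trace = 1 := by
    rw [ampLeft_conjMap, Matrix.trace_mul_comm, ← Matrix.mul_assoc, hVV, Matrix.one_mul,
      σ.trace_one]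
  have h2 := abs_sum_mul_diag_ampLeft_le hδ hF (hp.submatrix Prod.swap)
    (((Equiv.prodComm κ d).sum_comp fun a => ampLeft (conjMap V) σ.mat a a).trans ht)
    (fun x => c x.swap) fun x => hc x.swap
  have h3 : ∑ x : κ × d, c x.swap * (ampLeft (F.map - conjMap W)
      ((ampLeft (conjMap V) σ.mat).submatrix Prod.swap Prod.swap) x x).re =
      ∑ x, c x * (ampLeft (conjMap V) (ampRight (F.map - conjMap W) σ.mat) x x).re := by
    rw [ampLeft_ampRight_comm]
    exact (Equiv.prodComm κ d).sum_comp fun x =>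
      c x * (ampRight (F.map - conjMap W) (ampLeft (conjMap V) σ.mat) x x).re
  rw [h3] at h2
  have h4 : (V ⊗ₖ W) * σ.mat * (V ⊗ₖ W)ᴴ =
      ampLeft (conjMap V) (ampRight (conjMap W) σ.mat) := by
    have hVW : V ⊗ₖ W = (V ⊗ₖ (1 : Matrix κ κ ℂ)) * ((1 : Matrix d d ℂ) ⊗ₖ W) := by
      rw [← Matrix.mul_kronecker_mul, Matrix.mul_one, Matrix.one_mul]
    rw [ampLeft_conjMap, ampRight_conjMap, hVW, Matrix.conjTranspose_mul]
    simp only [Matrix.mul_assoc]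
  have h5 : ∀ x, ((σ.applyTensor E F).mat x x).re - (((V ⊗ₖ W) * σ.mat * (V ⊗ₖ W)ᴴ) x x).re =
      (ampLeft (E.map - conjMap V) (ampRight F.map σ.mat) x x).re +
      (ampLeft (conjMap V) (ampRight (F.map - conjMap W) σ.mat) x x).re := by
    intro x
    have h6 : ampLeft (conjMap V) (ampRight (F.map - conjMap W) σ.mat) =
        ampLeft (conjMap V) (ampRight F.map σ.mat) -
        ampLeft (conjMap V) (ampRight (conjMap W) σ.mat) := by
      rw [ampLeft_conjMap, ampLeft_conjMap, ampLeft_conjMap, ← Matrix.sub_mul, ← Matrix.mul_sub]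
      rfl
    rw [h4, h6]
    change _ = ((E.map _ - conjMap V _) _ _).re + _
    simp only [Matrix.sub_apply, Complex.sub_re]
    change (ampLeft E.map (ampRight F.map σ.mat) x x).re - _ =
      (ampLeft E.map (ampRight F.map σ.mat) x x).re -
        (ampLeft (conjMap V) (ampRight F.map σ.mat) x x).re + _
    ring
  rw [← Finset.sum_sub_distrib]
  simp_rw [← mul_sub, h5, mul_add, Finset.sum_add_distrib]
  exact (abs_add_le _ _).trans (by linarith)

end TraceNorm

/-! ### Unitarity of the gates, branches and boxes -/

section Unitary

variable {Q : Type} [Fintype Q] [DecidableEq Q]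

theorem onQubit_eq_submatrix (q : Q) (u : Matrix (Fin 2) (Fin 2) ℂ) :
    onQubit q u = (u ⊗ₖ (1 : Matrix ({p // p ≠ q} → Fin 2) _ ℂ)).submatrix
      (Equiv.funSplitAt q (Fin 2)) (Equiv.funSplitAt q (Fin 2)) := by
  ext x y
  simp [onQubit, Matrix.one_apply, funext_iff]

theorem submatrix_mem_unitaryGroup {ι κ : Type} [Fintype ι] [DecidableEq ι] [Fintype κ]
    [DecidableEq κ] (e : ι ≃ κ) {M : Matrix κ κ ℂ} (hM : M ∈ Matrix.unitaryGroup κ ℂ) :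
    M.submatrix e e ∈ Matrix.unitaryGroup ι ℂ := by
  rw [Matrix.mem_unitaryGroup_iff, Matrix.star_eq_conjTranspose, Matrix.conjTranspose_submatrix,
    Matrix.submatrix_mul_equiv, ← Matrix.star_eq_conjTranspose,
    Matrix.mem_unitaryGroup_iff.1 hM, Matrix.submatrix_one_equiv]

theorem onQubit_mem_unitaryGroup (q : Q) {u : Matrix (Fin 2) (Fin 2) ℂ}
    (hu : u ∈ Matrix.unitaryGroup (Fin 2) ℂ) : onQubit q u ∈ Matrix.unitaryGroup (Q → Fin 2) ℂ := by
  rw [onQubit_eq_submatrix]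
  exact submatrix_mem_unitaryGroup _ (Matrix.kronecker_mem_unitary hu (one_mem _))

theorem controlledZ_mem_unitaryGroup (c t : Q) :
    controlledZ c t ∈ Matrix.unitaryGroup (Q → Fin 2) ℂ := by
  rw [Matrix.mem_unitaryGroup_iff, Matrix.star_eq_conjTranspose, controlledZ,
    Matrix.diagonal_conjTranspose, Matrix.diagonal_mul_diagonal, ← Matrix.diagonal_one]
  congr 1
  funext x
  by_cases h : x c = 1 ∧ x t = 1 <;> simp [h]

theorem pauliX_mem_unitaryGroup : pauliX ∈ Matrix.unitaryGroup (Fin 2) ℂ := by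
  rw [Matrix.mem_unitaryGroup_iff]
  ext i j
  fin_cases i <;> fin_cases j <;> simp [pauliX, Matrix.mul_apply]

theorem pauliZ_mem_unitaryGroup : pauliZ ∈ Matrix.unitaryGroup (Fin 2) ℂ := by
  rw [Matrix.mem_unitaryGroup_iff]
  ext i j
  fin_cases i <;> fin_cases j <;> simp [pauliZ, Matrix.mul_apply]

theorem phaseS_mem_unitaryGroup : phaseS ∈ Matrix.unitaryGroup (Fin 2) ℂ := by
  rw [Matrix.mem_unitaryGroup_iff]
  ext i j
  fin_cases i <;> fin_cases j <;> simp [phaseS, Matrix.mul_apply]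

theorem inv_sqrt_two_mul_self : ((√2 : ℝ) : ℂ)⁻¹ * ((√2 : ℝ) : ℂ)⁻¹ = 1 / 2 := by
  rw [← mul_inv, ← Complex.ofReal_mul, Real.mul_self_sqrt (by norm_num)]
  norm_num

theorem hadamard_mem_unitaryGroup : hadamard ∈ Matrix.unitaryGroup (Fin 2) ℂ := by
  rw [Matrix.mem_unitaryGroup_iff]
  ext i j
  fin_cases i <;> fin_cases j <;>
    simp [hadamard, Matrix.mul_apply, inv_sqrt_two_mul_self] <;> norm_num

theorem clifford_mem_unitaryGroup (l : Label) : clifford l ∈ Matrix.unitaryGroup (Fin 2) ℂ :=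
  mul_mem (mul_mem (pow_mem phaseS_mem_unitaryGroup _) (pow_mem hadamard_mem_unitaryGroup _))
    (pow_mem pauliX_mem_unitaryGroup _)

theorem branch_mem_unitaryGroup (P : Q → Prop) [DecidablePred P] (circ : List (Gate Q))
    (i : ℕ → Fin 2) : branch P circ i ∈ Matrix.unitaryGroup ({q // P q} → Fin 2) ℂ := by
  induction circ generalizing i with
  | nil => exact one_mem _
  | cons g gs ih =>
    cases g with
    | single q u =>
      rw [branch]
      split_ifs
      · exact mul_mem (ih i) (onQubit_mem_unitaryGroup _ u.2)
      · exact ih i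
    | cz c t hct =>
      have hZ (p : {q // P q}) := onQubit_mem_unitaryGroup p
        (pow_mem pauliZ_mem_unitaryGroup (i 0 : ℕ))
      rw [branch]
      split_ifs
      · exact mul_mem (ih i) (controlledZ_mem_unitaryGroup _ _)
      · exact mul_mem (ih _) (hZ _)
      · exact mul_mem (ih _) (hZ _)
      · exact ih i

theorem onAncilla_mem_unitaryGroup {κ : Type} [Fintype κ] [DecidableEq κ]
    {u : Matrix (Fin 2) (Fin 2) ℂ} (hu : u ∈ Matrix.unitaryGroup (Fin 2) ℂ) :
    (onAncilla u : Matrix (Fin 2 × κ) _ ℂ) ∈ Matrix.unitaryGroup (Fin 2 × κ) ℂ :=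
  Matrix.kronecker_mem_unitary hu (one_mem _)

theorem controlled_mem_unitaryGroup {κ : Type} [Fintype κ] [DecidableEq κ] {M : Matrix κ κ ℂ}
    (hM : M ∈ Matrix.unitaryGroup κ ℂ) : controlled M ∈ Matrix.unitaryGroup (Fin 2 × κ) ℂ := by
  have h := Matrix.mem_unitaryGroup_iff.1 hM
  rw [Matrix.star_eq_conjTranspose] at h
  rw [Matrix.mem_unitaryGroup_iff, Matrix.star_eq_conjTranspose, controlled,
    Matrix.conjTranspose_add, Matrix.conjTranspose_kronecker, Matrix.conjTranspose_kronecker,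
    mul_add, add_mul, add_mul]
  simp only [← Matrix.mul_kronecker_mul, h, Matrix.conjTranspose_one, mul_one]
  ext ⟨a, x⟩ ⟨b, y⟩
  fin_cases a <;> fin_cases b <;>
    simp [Matrix.one_apply, Matrix.vecMul_eq_sum]

theorem firstBox_mem_unitaryGroup {κ : Type} [Fintype κ] [DecidableEq κ] {V V' : Matrix κ κ ℂ}
    (hV : V ∈ Matrix.unitaryGroup κ ℂ) (hV' : V' ∈ Matrix.unitaryGroup κ ℂ) (l : Label) :
    firstBox V V' l ∈ Matrix.unitaryGroup (Fin 2 × κ) ℂ :=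
  mul_mem (mul_mem (mul_mem (mul_mem (mul_mem
    (onAncilla_mem_unitaryGroup (Unitary.star_mem (clifford_mem_unitaryGroup l)))
    (controlled_mem_unitaryGroup (Unitary.star_mem hV')))
    (onAncilla_mem_unitaryGroup pauliX_mem_unitaryGroup))
    (controlled_mem_unitaryGroup (Unitary.star_mem hV)))
    (onAncilla_mem_unitaryGroup pauliX_mem_unitaryGroup))
    (onAncilla_mem_unitaryGroup hadamard_mem_unitaryGroup)

end Unitary

/-! ### Operators on a device -/

section Device

variable {S : Type} [Fintype S] [DecidableEq S] {N : ℕ} (π : Option S ↪ Fin N)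

/-- The assignment of the device qubits that agrees with `w` at the places given by `π` and with
`x` elsewhere. -/
noncomputable def place (x : Fin N → Fin 2) (w : Fin 2 × (S → Fin 2)) : Fin N → Fin 2 :=
  Function.extend π (fun o => o.elim w.1 w.2) x

/-- The bits of a device assignment at the places given by `π`. -/
def readOff (x : Fin N → Fin 2) : Fin 2 × (S → Fin 2) := (x (π none), fun s => x (π (some s)))

omit [Fintype S] [DecidableEq S] in
theorem readOff_place (x : Fin N → Fin 2) (w : Fin 2 × (S → Fin 2)) :
    readOff π (place π x w) = w := by
  simp [readOff, place, π.injective.extend_apply]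

omit [Fintype S] [DecidableEq S] in
theorem place_of_ne {x : Fin N → Fin 2} (w : Fin 2 × (S → Fin 2)) {p : Fin N}
    (hp : ∀ o, π o ≠ p) : place π x w p = x p := by
  rw [place, Function.extend_apply']
  rintro ⟨o, ho⟩
  exact hp o ho

omit [Fintype S] [DecidableEq S] in
theorem place_readOff {x y : Fin N → Fin 2} (h : ∀ p, (∀ o, π o ≠ p) → y p = x p) :
    place π x (readOff π y) = y := by
  funext p
  by_cases hp : ∃ o, π o = p
  · obtain ⟨o, rfl⟩ := hp
    cases o <;> simp [place, readOff, π.injective.extend_apply]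
  · push Not at hp
    rw [place_of_ne π _ hp, h p hp]

omit [Fintype S] [DecidableEq S] in
theorem readOff_eq_iff {x y : Fin N → Fin 2} (h : ∀ p, (∀ o, π o ≠ p) → y p = x p) :
    readOff π x = readOff π y ↔ x = y := by
  refine ⟨fun hr => ?_, fun hr => hr ▸ rfl⟩
  rw [← place_readOff π h, ← hr, place_readOff π fun p _ => rfl]

/-- A sum over the device assignments that agree with `x` off the range of `π`. -/
theorem sum_agree_off {M : Type*} [AddCommMonoid M] (x : Fin N → Fin 2)
    (g : (Fin N → Fin 2) → M) :
    ∑ y, (if ∀ p, (∀ o, π o ≠ p) → y p = x p then g y else 0) = ∑ w, g (place π x w) := by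
  rw [← Finset.sum_filter]
  refine Finset.sum_bij' (fun y _ => readOff π y) (fun w _ => place π x w) (by simp) ?_ ?_ ?_ ?_
  · intro w _
    simpa using fun p hp => place_of_ne π w hp
  · intro y hy
    exact place_readOff π (by simpa using hy)
  · intro w _
    exact readOff_place π x w
  · intro y hy
    rw [place_readOff π (by simpa using hy)]

theorem onDevice_conjTranspose_mul_self {M : Matrix (Fin 2 × (S → Fin 2)) (Fin 2 × (S → Fin 2)) ℂ}
    (hM : M ∈ Matrix.unitaryGroup (Fin 2 × (S → Fin 2)) ℂ) :
    (onDevice π M)ᴴ * onDevice π M = 1 := by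
  classical
  have hM' := Matrix.mem_unitaryGroup_iff'.1 hM
  ext x y
  have h1 : ∀ z, (onDevice π M)ᴴ x z * onDevice π M z y =
      if ∀ p, (∀ o, π o ≠ p) → z p = x p then
        (if ∀ p, (∀ o, π o ≠ p) → z p = y p then
          star (M (readOff π z) (readOff π x)) * M (readOff π z) (readOff π y) else 0)
      else 0 := by
    intro z
    rw [Matrix.conjTranspose_apply]
    unfold onDevice
    split_ifs <;> simp [readOff]
  have h2 : ∀ w, (∀ p, (∀ o, π o ≠ p) → place π x w p = y p) ↔
      ∀ p, (∀ o, π o ≠ p) → y p = x p := fun w =>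
    forall₂_congr fun p hp => by rw [place_of_ne π w hp, eq_comm]
  simp_rw [Matrix.mul_apply, h1]
  rw [sum_agree_off π x]
  simp_rw [readOff_place, h2]
  split_ifs with h
  · have h3 := congrFun (congrFun hM' (readOff π x)) (readOff π y)
    rw [Matrix.mul_apply] at h3
    refine h3.trans ?_
    rw [Matrix.one_apply, Matrix.one_apply]
    simp only [readOff_eq_iff π h]
  · rw [Finset.sum_const_zero, Matrix.one_apply, if_neg]
    rintro rfl
    exact h fun _ _ => rfl

/-- Products of columns of an operator on the device, at assignments agreeing off the range of `π`. -/
theorem sum_onDevice_mul (M : Matrix (Fin 2 × (S → Fin 2)) (Fin 2 × (S → Fin 2)) ℂ)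
    (b : Fin 2 × (S → Fin 2) → ℂ) (x : Fin N → Fin 2) (v w : Fin 2 × (S → Fin 2)) :
    ∑ z, b (readOff π z) * (star (onDevice π M z (place π x v)) * onDevice π M z (place π x w)) =
      ∑ u, b u * (star (M u v) * M u w) := by
  classical
  have h1 : ∀ z w, onDevice π M z (place π x w) =
      if ∀ p, (∀ o, π o ≠ p) → z p = x p then M (readOff π z) w else 0 := by
    intro z w
    have h2 : (∀ p, (∀ o, π o ≠ p) → z p = place π x w p) ↔
        ∀ p, (∀ o, π o ≠ p) → z p = x p :=
      forall₂_congr fun p hp => by rw [place_of_ne π w hp]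
    have h3 : M (readOff π z) (readOff π (place π x w)) = M (readOff π z) w := by
      rw [readOff_place]
    unfold onDevice
    simp only [h2]
    exact if_congr Iff.rfl h3 rfl
  have h4 : ∀ z, b (readOff π z) *
      (star (onDevice π M z (place π x v)) * onDevice π M z (place π x w)) =
      if ∀ p, (∀ o, π o ≠ p) → z p = x p then
        b (readOff π z) * (star (M (readOff π z) v) * M (readOff π z) w) else 0 := by
    intro z
    rw [h1, h1]
    split_ifs <;> simp
  simp_rw [h4]
  rw [sum_agree_off π x]
  simp_rw [readOff_place]

end Device

/-! ### The cut of a circuit -/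

section Cut

variable {Q : Type} [Fintype Q] [DecidableEq Q] (P : Q → Prop) [DecidablePred P]

/-- The operator `V ⊗ W` on all qubits, for `V` acting on the qubits satisfying `P` and `W` on the
others. -/
def cutTensor (V : Matrix ({q // P q} → Fin 2) ({q // P q} → Fin 2) ℂ)
    (W : Matrix ({q // ¬ P q} → Fin 2) ({q // ¬ P q} → Fin 2) ℂ) :
    Matrix (Q → Fin 2) (Q → Fin 2) ℂ :=
  (V ⊗ₖ W).submatrix (Equiv.piEquivPiSubtypeProd P fun _ => Fin 2)
    (Equiv.piEquivPiSubtypeProd P fun _ => Fin 2)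

omit [Fintype Q] [DecidableEq Q] in
theorem cutTensor_apply (V : Matrix ({q // P q} → Fin 2) ({q // P q} → Fin 2) ℂ)
    (W : Matrix ({q // ¬ P q} → Fin 2) ({q // ¬ P q} → Fin 2) ℂ) (x y : Q → Fin 2) :
    cutTensor P V W x y = V (fun q => x q) (fun q => y q) * W (fun q => x q) (fun q => y q) :=
  rfl

theorem cutTensor_mul [Fintype {q // P q}] [Fintype {q // ¬ P q}]
    (V V' : Matrix ({q // P q} → Fin 2) ({q // P q} → Fin 2) ℂ)
    (W W' : Matrix ({q // ¬ P q} → Fin 2) ({q // ¬ P q} → Fin 2) ℂ) :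
    cutTensor P V W * cutTensor P V' W' = cutTensor P (V * V') (W * W') := by
  rw [cutTensor, cutTensor, cutTensor, Matrix.submatrix_mul_equiv, Matrix.mul_kronecker_mul]

omit [Fintype Q] [DecidableEq Q] in
theorem cutTensor_conjTranspose (V : Matrix ({q // P q} → Fin 2) ({q // P q} → Fin 2) ℂ)
    (W : Matrix ({q // ¬ P q} → Fin 2) ({q // ¬ P q} → Fin 2) ℂ) :
    (cutTensor P V W)ᴴ = cutTensor P Vᴴ Wᴴ := by
  rw [cutTensor, cutTensor, Matrix.conjTranspose_submatrix, Matrix.conjTranspose_kronecker]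

theorem onQubit_eq_cutTensor_of_mem {q : Q} (h : P q) (u : Matrix (Fin 2) (Fin 2) ℂ) :
    onQubit q u = cutTensor P (onQubit ⟨q, h⟩ u) 1 := by
  ext x y
  rw [cutTensor_apply]
  simp only [onQubit, Matrix.one_apply, funext_iff, Subtype.forall, ne_eq, Subtype.mk.injEq,
    mul_ite, mul_one, mul_zero, ← ite_and]
  refine if_congr ⟨fun H => ⟨fun p hp => ?_, fun p _ => H p⟩, fun H p hp => ?_⟩ rfl rfl
  · exact H p (by rintro rfl; exact hp h)
  · by_cases hA : P p
    · exact H.2 p hA hp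
    · exact H.1 p hA

theorem onQubit_eq_cutTensor_of_notMem {q : Q} (h : ¬ P q) (u : Matrix (Fin 2) (Fin 2) ℂ) :
    onQubit q u = cutTensor P 1 (onQubit ⟨q, h⟩ u) := by
  ext x y
  rw [cutTensor_apply]
  simp only [onQubit, Matrix.one_apply, funext_iff, Subtype.forall, ne_eq, Subtype.mk.injEq,
    ite_mul, zero_mul, one_mul, ← ite_and]
  refine if_congr ⟨fun H => ⟨fun p hp => ?_, fun p _ => H p⟩, fun H p hp => ?_⟩ rfl rfl
  · exact H p (by rintro rfl; exact h hp)
  · by_cases hA : P p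
    · exact H.1 p hA
    · exact H.2 p hA hp

omit [DecidableEq Q] in
theorem cutTensor_diagonal [DecidableEq ({q // P q} → Fin 2)]
    [DecidableEq ({q // ¬ P q} → Fin 2)]
    (f : ({q // P q} → Fin 2) → ℂ) (g : ({q // ¬ P q} → Fin 2) → ℂ) :
    cutTensor P (Matrix.diagonal f) (Matrix.diagonal g) =
      Matrix.diagonal fun x : Q → Fin 2 => f (fun q => x q) * g (fun q => x q) := by
  rw [cutTensor, Matrix.diagonal_kronecker_diagonal, Matrix.submatrix_diagonal_equiv]
  rfl

theorem controlledZ_eq_cutTensor_of_mem {c t : Q} (hc : P c) (ht : P t) :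
    controlledZ c t = cutTensor P (controlledZ ⟨c, hc⟩ ⟨t, ht⟩) 1 := by
  rw [controlledZ, controlledZ, ← Matrix.diagonal_one, cutTensor_diagonal]
  simp

theorem controlledZ_eq_cutTensor_of_notMem {c t : Q} (hc : ¬ P c) (ht : ¬ P t) :
    controlledZ c t = cutTensor P 1 (controlledZ ⟨c, hc⟩ ⟨t, ht⟩) := by
  rw [controlledZ, controlledZ, ← Matrix.diagonal_one, cutTensor_diagonal]
  simp

theorem controlledZ_comm (c t : Q) : controlledZ c t = controlledZ t c := by
  simp only [controlledZ, and_comm]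

theorem pauliZ_pow (b : Fin 2) : pauliZ ^ (b : ℕ) = Matrix.diagonal fun a : Fin 2 =>
    (-1 : ℂ) ^ ((b : ℕ) * (a : ℕ)) := by
  ext i j
  fin_cases b <;> fin_cases i <;> fin_cases j <;> simp [pauliZ]

theorem onQubit_pauliZ_pow (q : Q) (b : Fin 2) : onQubit q (pauliZ ^ (b : ℕ)) =
    Matrix.diagonal fun x : Q → Fin 2 => (-1 : ℂ) ^ ((b : ℕ) * (x q : ℕ)) := by
  ext x y
  by_cases h : x = y
  · subst h
    simp [onQubit, pauliZ_pow]
  · rw [Matrix.diagonal_apply_ne _ h, onQubit]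
    split_ifs with h1
    · rw [pauliZ_pow, Matrix.diagonal_apply_ne]
      intro h2
      exact h (funext fun p => if hp : p = q then hp ▸ h2 else h1 p hp)
    · rfl

/-- The decomposition `CZ = ½ ∑ (-1)^(ab) Z^a ⊗ Z^b` of a gate across the cut. -/
theorem controlledZ_eq_sum {c t : Q} (hc : P c) (ht : ¬ P t) :
    controlledZ c t = (2 : ℂ)⁻¹ • ∑ a : Fin 2, ∑ b : Fin 2, (-1 : ℂ) ^ ((a : ℕ) * (b : ℕ)) •
      cutTensor P (onQubit ⟨c, hc⟩ (pauliZ ^ (a : ℕ))) (onQubit ⟨t, ht⟩ (pauliZ ^ (b : ℕ))) := by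
  simp only [onQubit_pauliZ_pow, cutTensor_diagonal]
  ext x y
  by_cases h : x = y
  · subst h
    simp only [controlledZ, Matrix.diagonal_apply_eq, Matrix.smul_apply, Fin.sum_univ_two,
      Matrix.add_apply]
    generalize x c = a
    generalize x t = b
    obtain rfl | rfl : a = 0 ∨ a = 1 := by omega
    all_goals obtain rfl | rfl : b = 0 ∨ b = 1 := by omega
    all_goals norm_num
  · simp [controlledZ, h]

theorem extendBits_cons_zero {D : ℕ} (a : Fin 2) (i : Fin D → Fin 2) :
    extendBits (Fin.cons a i : Fin (D + 1) → Fin 2) 0 = a := by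
  simp [extendBits]

theorem extendBits_cons_succ {D : ℕ} (a : Fin 2) (i : Fin D → Fin 2) :
    (fun k => extendBits (Fin.cons a i : Fin (D + 1) → Fin 2) (k + 1)) = extendBits i := by
  funext k
  simp only [extendBits, Nat.add_lt_add_iff_right]
  split_ifs
  · exact Fin.cons_succ (α := fun _ => Fin 2) a i ⟨k, _⟩
  · rfl

theorem dotBits_cons {D : ℕ} (a b : Fin 2) (i j : Fin D → Fin 2) :
    dotBits (Fin.cons a i : Fin (D + 1) → Fin 2) (Fin.cons b j : Fin (D + 1) → Fin 2) =
      (a : ℕ) * (b : ℕ) + dotBits i j := by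
  simp [dotBits, Fin.sum_univ_succ]

theorem sum_bits_succ {D : ℕ} {M : Type*} [AddCommMonoid M] (f : (Fin (D + 1) → Fin 2) → M) :
    ∑ i, f i = ∑ a : Fin 2, ∑ i : Fin D → Fin 2, f (Fin.cons a i : Fin (D + 1) → Fin 2) := by
  rw [← (Fin.consEquiv fun _ : Fin (D + 1) => Fin 2).sum_comp, Fintype.sum_prod_type]
  rfl

/-- `U = 2⁻ᴰ ∑ (-1)^(i⬝j) V_i ⊗ W_j`. -/
theorem circuitMatrix_eq_sum (A : Finset Q) (hP : ∀ q, P q ↔ q ∈ A) (circ : List (Gate Q))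
    {D : ℕ} (hD : cutSize A circ = D) :
    circuitMatrix circ = ((2 : ℂ) ^ D)⁻¹ • ∑ i : Fin D → Fin 2, ∑ j : Fin D → Fin 2,
      (-1 : ℂ) ^ dotBits i j • cutTensor P (branch P circ (extendBits i))
        (branch (fun q => ¬ P q) circ (extendBits j)) := by
  induction circ generalizing D with
  | nil =>
    obtain rfl : D = 0 := by simpa [cutSize] using hD.symm
    have h : cutTensor P (1 : Matrix _ _ ℂ) (1 : Matrix _ _ ℂ) = 1 := by
      rw [← Matrix.diagonal_one, ← Matrix.diagonal_one, cutTensor_diagonal]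
      simp
    simp [branch, dotBits, circuitMatrix]
    exact h.symm
  | cons g gs ih =>
    have inner (h : Gate.crosses A g = false) : cutSize A gs = D := by
      simpa [cutSize, List.countP_cons, h] using hD
    -- A gate that does not cross the cut is a factor `K` of every term.
    have step {K : Matrix (Q → Fin 2) (Q → Fin 2) ℂ} (hK : g.matrix = K)
        (h : Gate.crosses A g = false)
        (hb : ∀ i j : ℕ → Fin 2,
          cutTensor P (branch P (g :: gs) i) (branch (fun q => ¬ P q) (g :: gs) j) =
          cutTensor P (branch P gs i) (branch (fun q => ¬ P q) gs j) * K) :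
        circuitMatrix (g :: gs) = ((2 : ℂ) ^ D)⁻¹ • ∑ i : Fin D → Fin 2, ∑ j : Fin D → Fin 2,
          (-1 : ℂ) ^ dotBits i j •
            cutTensor P (branch P (g :: gs) (extendBits i))
              (branch (fun q => ¬ P q) (g :: gs) (extendBits j)) := by
      rw [circuitMatrix, hK, ih (inner h)]
      simp only [hb, Matrix.smul_mul, Matrix.sum_mul]
    have cross {D : ℕ} {c t : Q} (hc : P c) (ht : ¬ P t)
        (hD : cutSize A gs = D) (hg : g.matrix = controlledZ c t)
        (hV : ∀ i, branch P (g :: gs) i =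
          branch P gs (fun k => i (k + 1)) *
            onQubit ⟨c, hc⟩ (pauliZ ^ (i 0 : ℕ)))
        (hW : ∀ i, branch (fun q => ¬ P q) (g :: gs) i =
          branch (fun q => ¬ P q) gs (fun k => i (k + 1)) *
            onQubit ⟨t, ht⟩ (pauliZ ^ (i 0 : ℕ))) :
        circuitMatrix (g :: gs) = ((2 : ℂ) ^ (D + 1))⁻¹ •
          ∑ i : Fin (D + 1) → Fin 2, ∑ j : Fin (D + 1) → Fin 2, (-1 : ℂ) ^ dotBits i j •
            cutTensor P (branch P (g :: gs) (extendBits i))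
              (branch (fun q => ¬ P q) (g :: gs) (extendBits j)) := by
      rw [circuitMatrix, hg, ih hD, controlledZ_eq_sum P hc ht, sum_bits_succ]
      simp_rw [sum_bits_succ, hV, hW, extendBits_cons_zero, extendBits_cons_succ, dotBits_cons,
        ← cutTensor_mul]
      rw [Matrix.smul_mul, Matrix.mul_smul, smul_smul, pow_succ, mul_inv, Matrix.mul_sum]
      congr 1
      refine Finset.sum_congr rfl fun a _ => ?_
      refine Eq.trans ?_ Finset.sum_comm
      rw [Matrix.mul_sum]
      refine Finset.sum_congr rfl fun b _ => ?_
      rw [Matrix.sum_mul]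
      refine Finset.sum_congr rfl fun i _ => ?_
      rw [Matrix.sum_mul]
      refine Finset.sum_congr rfl fun j _ => ?_
      rw [Matrix.smul_mul, Matrix.mul_smul, smul_smul, pow_add, mul_comm]
    cases g with
    | single q u =>
      by_cases h : P q
      · refine step (onQubit_eq_cutTensor_of_mem P h u) rfl fun i j => ?_
        rw [cutTensor_mul]
        simp [branch, h]
      · refine step (onQubit_eq_cutTensor_of_notMem P h u) rfl fun i j => ?_
        rw [cutTensor_mul]
        simp [branch, h]
    | cz c t hct =>
      by_cases hc : P c <;> by_cases ht : P t
      · refine step (controlledZ_eq_cutTensor_of_mem P hc ht) (by simp [Gate.crosses, ← hP, hc, ht])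
          fun i j => ?_
        rw [cutTensor_mul]
        simp [branch, hc, ht]
      · obtain rfl : D = cutSize A gs + 1 := by
          simpa [cutSize, List.countP_cons, Gate.crosses, ← hP, hc, ht] using hD.symm
        exact cross hc ht rfl rfl (fun i => by simp [branch, hc, ht])
          (fun i => by simp [branch, hc, ht])
      · obtain rfl : D = cutSize A gs + 1 := by
          simpa [cutSize, List.countP_cons, Gate.crosses, ← hP, hc, ht] using hD.symm
        exact cross ht hc rfl (controlledZ_comm c t) (fun i => by simp [branch, hc, ht])
          (fun i => by simp [branch, hc, ht])
      · refine step (controlledZ_eq_cutTensor_of_notMem P hc ht)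
          (by simp [Gate.crosses, ← hP, hc, ht]) fun i j => ?_
        rw [cutTensor_mul]
        simp [branch, hc, ht]

end Cut

/-! ### The observables measured by the two boxes -/

section Box

variable {κ : Type} [Fintype κ] [DecidableEq κ]

theorem controlled_mul_pauliX (V V' : Matrix κ κ ℂ) :
    controlled V' * onAncilla pauliX * controlled V * onAncilla pauliX =
      !![1, 0; 0, 0] ⊗ₖ V + !![0, 0; 0, 1] ⊗ₖ V' := by
  simp only [controlled, onAncilla, add_mul, mul_add, ← Matrix.mul_kronecker_mul, mul_one,
    one_mul]
  ext ⟨a, x⟩ ⟨b, y⟩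
  fin_cases a <;> fin_cases b <;> simp [pauliX]

theorem box_apply (L R : Matrix (Fin 2) (Fin 2) ℂ) (V : Fin 2 → Matrix κ κ ℂ) (o : Fin 2)
    (u y : κ) :
    (onAncilla L * controlled (V 1) * onAncilla pauliX * controlled (V 0) * onAncilla pauliX *
      onAncilla R : Matrix (Fin 2 × κ) (Fin 2 × κ) ℂ) (o, u) (0, y) =
      ∑ a, L o a * R a 0 * V a u y := by
  have h : (onAncilla L : Matrix (Fin 2 × κ) (Fin 2 × κ) ℂ) * controlled (V 1) *
      onAncilla pauliX * controlled (V 0) *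
      onAncilla pauliX * onAncilla R =
      onAncilla L * (controlled (V 1) * onAncilla pauliX * controlled (V 0) *
        onAncilla pauliX) * onAncilla R := by simp only [Matrix.mul_assoc]
  rw [h, controlled_mul_pauliX]
  simp only [onAncilla, add_mul, mul_add, ← Matrix.mul_kronecker_mul, mul_one, one_mul]
  simp [Matrix.mul_apply, Fin.sum_univ_two]

/-- The diagonal observable `s ⊗ χ` after a box is, on inputs with ancilla `|0⟩`, a combination of
the operators `V_b χ V_a†` with coefficients that depend only on the ancilla gates. -/
theorem box_observable (L R : Matrix (Fin 2) (Fin 2) ℂ) (V : Fin 2 → Matrix κ κ ℂ)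
    (s : Fin 2 → ℂ) (χ : κ → ℂ) {B : Matrix (Fin 2 × κ) (Fin 2 × κ) ℂ}
    (hB : B = onAncilla L * controlled (V 1)ᴴ * onAncilla pauliX * controlled (V 0)ᴴ *
      onAncilla pauliX * onAncilla R) (z y : κ) :
    ∑ w : Fin 2 × κ, s w.1 * χ w.2 * (star (B w (0, z)) * B w (0, y)) =
      ∑ a, ∑ b, (∑ o, s o * (star (L o b) * L o a)) * (star (R b 0) * R a 0) *
        (V b * Matrix.diagonal χ * (V a)ᴴ) z y := by
  have h (o u y) := box_apply L R (fun a => (V a)ᴴ) o u y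
  simp only [← hB] at h
  have h2 (a b) : (V b * Matrix.diagonal χ * (V a)ᴴ) z y =
      ∑ u, V b z u * χ u * star (V a y u) := by
    simp [Matrix.mul_apply (N := (V a)ᴴ), Matrix.mul_diagonal]
  simp only [h, h2, Fintype.sum_prod_type, Matrix.conjTranspose_apply, Finset.mul_sum,
    Finset.sum_mul, star_sum, star_mul', star_star]
  rw [Finset.sum_congr rfl fun o _ => Finset.sum_comm.trans
    (Finset.sum_congr rfl fun a _ => Finset.sum_comm), Finset.sum_comm]
  refine Finset.sum_congr rfl fun a _ => ?_
  rw [Finset.sum_comm]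
  refine Finset.sum_congr rfl fun b _ => ?_
  rw [Finset.sum_comm]
  refine Finset.sum_congr rfl fun u _ => ?_
  refine Finset.sum_congr rfl fun o _ => ?_
  ring

/-- The sign that the first ancilla contributes to the result of a run. -/
def ancillaSign (l : Label) (o : Fin 2) : ℂ :=
  (-1) ^ ((1 + if l.1 = 0 ∧ l.2.1 = 0 then 1 else 0) * (o : ℕ))

/-- The identity `∑_l (C_l s_l C_l†) ⊗ (C_l |0⟩⟨0| C_l†) = I ⊗ I + X ⊗ X + Y ⊗ Y + Z ⊗ Z = 2 SWAP`,
written in coordinates. -/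
theorem sum_clifford (a b c d : Fin 2) :
    ∑ l : Label, (∑ o, ancillaSign l o * (star ((clifford l)ᴴ o b) * (clifford l)ᴴ o a)) *
      (star (clifford l d 0) * clifford l c 0) = if a = c ∧ b = d then 2 else 0 := by
  have hr : (((√2 : ℝ) : ℂ)⁻¹) ^ 2 = 1 / 2 := by rw [sq, inv_sqrt_two_mul_self]
  have hr4 : (((√2 : ℝ) : ℂ)⁻¹) ^ 4 = 1 / 4 := by
    rw [show (4 : ℕ) = 2 * 2 from rfl, pow_mul, hr]
    norm_num
  simp only [Fintype.sum_prod_type, Fin.sum_univ_two, ancillaSign, clifford, phaseS, hadamard,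
    pauliX]
  fin_cases a <;> fin_cases b <;> fin_cases c <;> fin_cases d <;>
    simp [Matrix.mul_apply, Matrix.one_apply, Fin.sum_univ_two] <;>
    ring_nf <;> simp only [hr4, Complex.I_sq] <;> ring_nf

end Box

/-! ### The ideal expectation of a run -/

/-- The sum over all labels keeps only the operators in which the two ancillas are off-diagonal in
the same way. -/
theorem sum_label_mul_mul (p q : Fin 2 → Fin 2 → ℂ) :
    ∑ l : Label,
      (∑ a, ∑ b, (∑ o, ancillaSign l o * (star ((clifford l)ᴴ o b) * (clifford l)ᴴ o a)) *
        (star (hadamard b 0) * hadamard a 0) * p a b) *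
      (∑ c, ∑ d, (∑ o : Fin 2, (-1) ^ (o : ℕ) * (star (hadamard o d) * hadamard o c)) *
        (star (clifford l d 0) * clifford l c 0) * q c d) = p 1 0 * q 1 0 + p 0 1 * q 0 1 := by
  have h1 (a b : Fin 2) : star (hadamard b 0) * hadamard a 0 = 1 / 2 := by
    fin_cases a <;> fin_cases b <;> simp [hadamard, inv_sqrt_two_mul_self]
  have h2 (c d : Fin 2) : ∑ o : Fin 2, (-1 : ℂ) ^ (o : ℕ) * (star (hadamard o d) * hadamard o c) =
      if c = d then 0 else 1 := by
    fin_cases c <;> fin_cases d <;>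
      simp [hadamard, inv_sqrt_two_mul_self, Fin.sum_univ_two] <;> norm_num
  set F : Label → Fin 2 → Fin 2 → ℂ := fun l a b =>
    ∑ o, ancillaSign l o * (star ((clifford l)ᴴ o b) * (clifford l)ᴴ o a) with hF
  set G : Label → Fin 2 → Fin 2 → ℂ := fun l c d => star (clifford l d 0) * clifford l c 0 with hG
  have h3 (a b c d : Fin 2) : ∑ l, F l a b * G l c d = if a = c ∧ b = d then 2 else 0 :=
    sum_clifford a b c d
  simp only [h1, h2]
  have h4 : ∀ l : Label, (∑ a, ∑ b, F l a b * (1 / 2) * p a b) *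
      (∑ c, ∑ d, (if c = d then 0 else 1) * G l c d * q c d) =
      ∑ a, ∑ b, ∑ c, ∑ d, (F l a b * G l c d) *
        (1 / 2 * p a b * (if c = d then 0 else 1) * q c d) := by
    intro l
    simp only [Fin.sum_univ_two]
    ring
  change ∑ l, (∑ a, ∑ b, F l a b * (1 / 2) * p a b) *
      (∑ c, ∑ d, (if c = d then 0 else 1) * G l c d * q c d) = _
  simp_rw [h4]
  rw [Finset.sum_comm]
  simp_rw [Finset.sum_comm (s := (Finset.univ : Finset Label)), ← Finset.sum_mul, h3]
  simp only [Fin.sum_univ_two]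
  norm_num
  ring

section Run

variable {Q : Type} [Fintype Q] [DecidableEq Q] {N D : ℕ} {A : Finset Q}
  (π₁ : Option {q // q ∈ A} ↪ Fin N) (π₂ : Option {q // q ∉ A} ↪ Fin N)

/-- Heisenberg picture: an expectation after `M` acts on the loaded state is an expectation in the
original state. -/
theorem sum_mul_load_eq_trace (ρ : State (Q → Fin 2))
    (M : Matrix ((Fin N → Fin 2) × (Fin N → Fin 2)) ((Fin N → Fin 2) × (Fin N → Fin 2)) ℂ)
    (β : (Fin N → Fin 2) × (Fin N → Fin 2) → ℂ) :
    ∑ x, β x * (M * (ρ.load π₁ π₂).mat * Mᴴ) x x =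
      (ρ.mat * ((M * loadMatrix π₁ π₂)ᴴ * Matrix.diagonal β * (M * loadMatrix π₁ π₂))).trace := by
  set L := loadMatrix π₁ π₂ with hL
  have h : ∑ x, β x * (M * (ρ.load π₁ π₂).mat * Mᴴ) x x =
      (Matrix.diagonal β * (M * L * ρ.mat * (M * L)ᴴ)).trace := by
    have : M * (ρ.load π₁ π₂).mat * Mᴴ = M * L * ρ.mat * (M * L)ᴴ := by
      rw [Matrix.conjTranspose_mul]
      simp only [State.load, Matrix.mul_assoc, hL]
    rw [this]
    simp [Matrix.trace]
  rw [h, Matrix.mul_assoc (M * L), ← Matrix.mul_assoc, Matrix.trace_mul_comm, Matrix.mul_assoc,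
    Matrix.mul_assoc]

omit [Fintype Q] [DecidableEq Q] in
theorem mul_loadMatrix_apply
    (M : Matrix ((Fin N → Fin 2) × (Fin N → Fin 2)) ((Fin N → Fin 2) × (Fin N → Fin 2)) ℂ)
    (x : (Fin N → Fin 2) × (Fin N → Fin 2)) (z : Q → Fin 2) :
    (M * loadMatrix π₁ π₂) x z =
      M x (place π₁ 0 (0, fun q => z q), place π₂ 0 (0, fun q => z q)) := by
  rw [Matrix.mul_apply, Finset.sum_eq_single (loadBits π₁ π₂ z)]
  · simp only [loadMatrix, if_true, mul_one]
    rfl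
  · intro b _ hb
    simp [loadMatrix, hb]
  · simp

/-- The observable of a run whose sign is a product of functions of the two registers. -/
theorem load_observable_apply
    (B₁ : Matrix (Fin 2 × ({q // q ∈ A} → Fin 2)) (Fin 2 × ({q // q ∈ A} → Fin 2)) ℂ)
    (B₂ : Matrix (Fin 2 × ({q // q ∉ A} → Fin 2)) (Fin 2 × ({q // q ∉ A} → Fin 2)) ℂ)
    (c : ℂ) (b₁ : Fin 2 × ({q // q ∈ A} → Fin 2) → ℂ) (b₂ : Fin 2 × ({q // q ∉ A} → Fin 2) → ℂ)
    (z y : Q → Fin 2) :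
    (((onDevice π₁ B₁ ⊗ₖ onDevice π₂ B₂) * loadMatrix π₁ π₂)ᴴ *
      Matrix.diagonal (fun x : (Fin N → Fin 2) × (Fin N → Fin 2) =>
        c * b₁ (readOff π₁ x.1) * b₂ (readOff π₂ x.2)) *
      ((onDevice π₁ B₁ ⊗ₖ onDevice π₂ B₂) * loadMatrix π₁ π₂)) z y =
    c * ((∑ w, b₁ w * (star (B₁ w (0, fun q => z q)) * B₁ w (0, fun q => y q))) *
      ∑ w, b₂ w * (star (B₂ w (0, fun q => z q)) * B₂ w (0, fun q => y q))) := by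
  rw [← sum_onDevice_mul π₁ B₁ b₁ 0, ← sum_onDevice_mul π₂ B₂ b₂ 0, Matrix.mul_apply,
    Finset.sum_mul_sum, Fintype.sum_prod_type, Finset.mul_sum]
  refine Finset.sum_congr rfl fun x₁ _ => ?_
  rw [Finset.mul_sum]
  refine Finset.sum_congr rfl fun x₂ _ => ?_
  rw [Matrix.mul_diagonal, Matrix.conjTranspose_apply, mul_loadMatrix_apply, mul_loadMatrix_apply,
    Matrix.kroneckerMap_apply, Matrix.kroneckerMap_apply, star_mul']
  ring

/-- The sign of a run as a product of functions of the two registers. -/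
theorem betaValue_eq (k : Q → Fin 2) (i j i' j' : Fin D → Fin 2) (l : Label)
    (x : (Fin N → Fin 2) × (Fin N → Fin 2)) :
    (betaValue π₁ π₂ k i j i' j' l x : ℂ) = (-1) ^ (dotBits i j + dotBits i' j') *
      (ancillaSign l (readOff π₁ x.1).1 *
        (-1) ^ dotBits (readOff π₁ x.1).2 (fun q : {q // q ∈ A} => k q)) *
      ((-1) ^ ((readOff π₂ x.2).1 : ℕ) *
        (-1) ^ dotBits (readOff π₂ x.2).2 (fun q : {q // q ∉ A} => k q)) := by
  have h : dotBits (readBits π₁ π₂ x) k =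
      dotBits (readOff π₁ x.1).2 (fun q : {q // q ∈ A} => k q) +
        dotBits (readOff π₂ x.2).2 (fun q : {q // q ∉ A} => k q) := by
    simp only [dotBits]
    rw [← Fintype.sum_subtype_add_sum_subtype (· ∈ A)]
    congr 1
    · refine Finset.sum_congr (by ext; simp) fun q _ => ?_
      simp [readBits, readOff, q.2]
    · refine Finset.sum_congr (by ext; simp) fun q _ => ?_
      simp [readBits, readOff, q.2]
  rw [betaValue, h, ancillaSign]
  simp only [readOff]
  push_cast
  ring

theorem abs_betaValue (k : Q → Fin 2) (i j i' j' : Fin D → Fin 2) (l : Label)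
    (x : (Fin N → Fin 2) × (Fin N → Fin 2)) : |betaValue π₁ π₂ k i j i' j' l x| = 1 := by
  simp [betaValue, abs_mul]

/-- The observable `Z^k` on the qubits `ι`. -/
def zString {ι : Type} [Fintype ι] [DecidableEq ι] (k : ι → Fin 2) :
    Matrix (ι → Fin 2) (ι → Fin 2) ℂ :=
  Matrix.diagonal fun x => (-1) ^ dotBits x k

/-- The sum over all labels of the ideal expectations of a run. -/
theorem sum_label_ideal (ρ : State (Q → Fin 2)) (k : Q → Fin 2) (i j i' j' : Fin D → Fin 2)
    (V V' : Matrix ({q // q ∈ A} → Fin 2) ({q // q ∈ A} → Fin 2) ℂ)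
    (W W' : Matrix ({q // q ∉ A} → Fin 2) ({q // q ∉ A} → Fin 2) ℂ) :
    ∑ l : Label, ∑ x, (betaValue π₁ π₂ k i j i' j' l x : ℂ) *
      ((onDevice π₁ (firstBox V V' l) ⊗ₖ onDevice π₂ (secondBox W W' l)) * (ρ.load π₁ π₂).mat *
        (onDevice π₁ (firstBox V V' l) ⊗ₖ onDevice π₂ (secondBox W W' l))ᴴ) x x =
      (-1) ^ (dotBits i j + dotBits i' j') *
        ((ρ.mat * cutTensor (· ∈ A) (V * zString (fun q : {q // q ∈ A} => k q) * V'ᴴ)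
            (W * zString (fun q : {q // q ∉ A} => k q) * W'ᴴ)).trace +
          (ρ.mat * cutTensor (· ∈ A) (V' * zString (fun q : {q // q ∈ A} => k q) * Vᴴ)
            (W' * zString (fun q : {q // q ∉ A} => k q) * Wᴴ)).trace) := by
  simp_rw [sum_mul_load_eq_trace, ← Matrix.trace_sum, ← Matrix.mul_sum]
  rw [← Matrix.trace_add, ← mul_add, ← smul_eq_mul ((-1 : ℂ) ^ _), ← Matrix.trace_smul,
    ← Matrix.mul_smul]
  congr 2
  ext z y
  rw [Matrix.sum_apply]
  simp_rw [betaValue_eq]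
  have h (l : Label) := load_observable_apply π₁ π₂ (firstBox V V' l) (secondBox W W' l)
    ((-1) ^ (dotBits i j + dotBits i' j'))
    (fun w => ancillaSign l w.1 * (-1) ^ dotBits w.2 (fun q : {q // q ∈ A} => k q))
    (fun w => (-1) ^ (w.1 : ℕ) * (-1) ^ dotBits w.2 (fun q : {q // q ∉ A} => k q)) z y
  have h1 (l : Label) := box_observable (clifford l)ᴴ hadamard ![V, V'] (ancillaSign l)
    (fun u => (-1) ^ dotBits u (fun q : {q // q ∈ A} => k q)) (B := firstBox V V' l) rfl
    (fun q => z q) (fun q => y q)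
  have h2 (l : Label) := box_observable hadamard (clifford l) ![W, W'] (fun o => (-1) ^ (o : ℕ))
    (fun u => (-1) ^ dotBits u (fun q : {q // q ∉ A} => k q)) (B := secondBox W W' l) rfl
    (fun q => z q) (fun q => y q)
  simp_rw [h, h1, h2]
  rw [← Finset.mul_sum, sum_label_mul_mul, Matrix.smul_apply, Matrix.add_apply, smul_eq_mul,
    cutTensor_apply, cutTensor_apply]
  rfl

end Run

/-! ### The fidelity as an average over the cut circuit -/

section Fidelity

variable {Q : Type} [Fintype Q] [DecidableEq Q]

theorem sum_neg_one_pow_dotBits (x : Q → Fin 2) :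
    ∑ k : Q → Fin 2, (-1 : ℂ) ^ dotBits x k = if x = 0 then 2 ^ Fintype.card Q else 0 := by
  have h : ∑ k : Q → Fin 2, (-1 : ℂ) ^ dotBits x k =
      ∏ q, ∑ b : Fin 2, (-1 : ℂ) ^ ((x q : ℕ) * (b : ℕ)) := by
    rw [Finset.prod_univ_sum, Fintype.piFinset_univ]
    simp_rw [dotBits, Finset.prod_pow_eq_pow_sum]
  rw [h]
  split_ifs with hx
  · subst hx
    simp
  · obtain ⟨q, hq⟩ := Function.ne_iff.1 hx
    refine Finset.prod_eq_zero (Finset.mem_univ q) ?_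
    have hq1 : x q = 1 := Fin.eq_one_of_ne_zero _ hq
    simp [hq1]

theorem sum_zString : ∑ k : Q → Fin 2, zString k =
    (2 ^ Fintype.card Q : ℂ) • Matrix.diagonal (Pi.single (0 : Q → Fin 2) (1 : ℂ)) := by
  ext x y
  rw [Matrix.sum_apply, Matrix.smul_apply]
  by_cases h : x = y
  · subst h
    simp only [zString, Matrix.diagonal_apply_eq, sum_neg_one_pow_dotBits, Pi.single_apply]
    simp
  · simp [zString, h]

theorem sum_trace_zString (ρ : State (Q → Fin 2)) (circ : List (Gate Q)) :
    (2 ^ Fintype.card Q : ℝ)⁻¹ * ∑ k : Q → Fin 2,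
      ((ρ.mat * (circuitMatrix circ * zString k * (circuitMatrix circ)ᴴ)).trace).re =
      fidelity (outputVector circ) ρ := by
  set U := circuitMatrix circ with hU
  have h1 : ∑ k : Q → Fin 2, (ρ.mat * (U * zString k * Uᴴ)).trace =
      (2 ^ Fintype.card Q : ℂ) * (star (outputVector circ) ⬝ᵥ (ρ.mat *ᵥ outputVector circ)) := by
    rw [← Matrix.trace_sum, ← Matrix.mul_sum, ← Matrix.sum_mul, ← Matrix.mul_sum, sum_zString,
      Matrix.mul_smul, Matrix.smul_mul, Matrix.mul_smul, Matrix.trace_smul, smul_eq_mul]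
    congr 1
    rw [Matrix.mul_assoc U, ← Matrix.mul_assoc, Matrix.trace_mul_comm, Matrix.mul_assoc,
      outputVector, ← hU, Matrix.star_mulVec, Matrix.mulVec_mulVec, ← Matrix.dotProduct_mulVec,
      Matrix.mulVec_mulVec]
    simp [Matrix.trace, Pi.single_apply]
  rw [← Complex.re_sum, h1, fidelity]
  have h2 : (2 ^ Fintype.card Q : ℂ) = ((2 ^ Fintype.card Q : ℝ) : ℂ) := by push_cast; rfl
  rw [h2, Complex.re_ofReal_mul, inv_mul_cancel_left₀ (by positivity)]

theorem zString_eq_cutTensor (A : Finset Q) (k : Q → Fin 2) :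
    zString k = cutTensor (· ∈ A) (zString fun q : {q // q ∈ A} => k q)
      (zString fun q : {q // q ∉ A} => k q) := by
  rw [zString, zString, zString, cutTensor_diagonal]
  congr 1
  funext x
  rw [← pow_add]
  congr 1
  simp only [dotBits]
  rw [← Fintype.sum_subtype_add_sum_subtype (· ∈ A)]
  congr 1
  exact Finset.sum_congr (by ext; simp) fun _ _ => rfl

/-- The contribution of a quadruple `(i, j, i', j')` to the expectation of `U Z^k U†`. -/
def quadTerm {D : ℕ} (A : Finset Q) (circ : List (Gate Q)) (ρ : State (Q → Fin 2))
    (k : Q → Fin 2) (i j i' j' : Fin D → Fin 2) : ℂ :=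
  (-1) ^ (dotBits i j + dotBits i' j') *
    (ρ.mat * cutTensor (· ∈ A)
      (branch (fun q => q ∈ A) circ (extendBits i) * zString (fun q : {q // q ∈ A} => k q) *
        (branch (fun q => q ∈ A) circ (extendBits i'))ᴴ)
      (branch (fun q => q ∉ A) circ (extendBits j) * zString (fun q : {q // q ∉ A} => k q) *
        (branch (fun q => q ∉ A) circ (extendBits j'))ᴴ)).trace

theorem sum_quadTerm {D : ℕ} (A : Finset Q) (circ : List (Gate Q)) (hD : cutSize A circ = D)
    (ρ : State (Q → Fin 2)) (k : Q → Fin 2) :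
    ∑ i : Fin D → Fin 2, ∑ j : Fin D → Fin 2, ∑ i' : Fin D → Fin 2, ∑ j' : Fin D → Fin 2,
      quadTerm A circ ρ k i j i' j' =
      4 ^ D * (ρ.mat * (circuitMatrix circ * zString k * (circuitMatrix circ)ᴴ)).trace := by
  have hU := circuitMatrix_eq_sum (fun q => q ∈ A) A (fun _ => Iff.rfl) circ hD
  set S := ∑ i : Fin D → Fin 2, ∑ j : Fin D → Fin 2,
      (-1 : ℂ) ^ dotBits i j • cutTensor (fun q => q ∈ A)
        (branch (fun q => q ∈ A) circ (extendBits i))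
        (branch (fun q => q ∉ A) circ (extendBits j)) with hS
  have hU' : circuitMatrix circ = ((2 : ℂ) ^ D)⁻¹ • S := hU
  have h4 : (4 : ℂ) ^ D * (ρ.mat * (circuitMatrix circ * zString k * (circuitMatrix circ)ᴴ)).trace =
      (ρ.mat * (S * zString k * Sᴴ)).trace := by
    rw [hU', Matrix.conjTranspose_smul, Matrix.smul_mul, Matrix.smul_mul, Matrix.mul_smul,
      Matrix.mul_smul, Matrix.mul_smul, smul_smul, Matrix.trace_smul, smul_eq_mul, ← mul_assoc]
    have : (4 : ℂ) ^ D * (((2 : ℂ) ^ D)⁻¹ * star ((2 : ℂ) ^ D)⁻¹) = 1 := by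
      rw [show (4 : ℂ) = 2 * 2 by norm_num, mul_pow]
      simp
      field_simp
    rw [this, one_mul]
  rw [h4, hS]
  rw [Matrix.sum_mul, Matrix.sum_mul, Matrix.mul_sum, Matrix.trace_sum]
  refine Finset.sum_congr rfl fun i _ => ?_
  rw [Matrix.sum_mul, Matrix.sum_mul, Matrix.mul_sum, Matrix.trace_sum]
  refine Finset.sum_congr rfl fun j _ => ?_
  rw [Matrix.conjTranspose_sum, Matrix.mul_sum, Matrix.mul_sum, Matrix.trace_sum]
  refine Finset.sum_congr rfl fun i' _ => ?_
  rw [Matrix.conjTranspose_sum, Matrix.mul_sum, Matrix.mul_sum, Matrix.trace_sum]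
  refine Finset.sum_congr rfl fun j' _ => ?_
  rw [Matrix.conjTranspose_smul, Matrix.smul_mul, Matrix.smul_mul, Matrix.mul_smul,
    Matrix.mul_smul, Matrix.mul_smul, smul_smul, Matrix.trace_smul, smul_eq_mul,
    zString_eq_cutTensor A k, cutTensor_conjTranspose, cutTensor_mul, cutTensor_mul, quadTerm,
    pow_add]
  simp

end Fidelity

/-! ### Means of the steps of the algorithm -/

section Algorithm

variable {Q : Type} [Fintype Q] [DecidableEq Q] {N D : ℕ} {A : Finset Q}
  (π₁ : Option {q // q ∈ A} ↪ Fin N) (π₂ : Option {q // q ∉ A} ↪ Fin N)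
  (E₁ E₂ : (Fin D → Fin 2) → (Fin D → Fin 2) → Label → Channel (Fin N → Fin 2))
  (ρ : State (Q → Fin 2))

/-- The mean of the result of a run. -/
noncomputable def runMean (k : Q → Fin 2) (i j i' j' : Fin D → Fin 2) (l : Label) : ℝ :=
  ∑ x, betaValue π₁ π₂ k i j i' j' l x *
    (((ρ.load π₁ π₂).applyTensor (E₁ i i' l) (E₂ j j' l)).mat x x).re

theorem isExperiment_runOnce (k : Q → Fin 2) (i j i' j' : Fin D → Fin 2) (l : Label) :
    IsExperiment (runOnce π₁ π₂ E₁ E₂ ρ k i j i' j' l) 1 1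
      (runMean π₁ π₂ E₁ E₂ ρ k i j i' j' l) := by
  refine IsExperiment.map_of_hasSum (fun x _ => (abs_betaValue π₁ π₂ k i j i' j' l x).le)
    (fun _ _ => rfl) ?_
  convert hasSum_fintype _ using 1
  refine Finset.sum_congr rfl fun x _ => ?_
  have h0 : 0 ≤ (((ρ.load π₁ π₂).applyTensor (E₁ i i' l) (E₂ j j' l)).mat x x).re :=
    (Complex.le_def.1 (State.posSemidef _).diag_nonneg).1
  rw [State.measure, PMF.ofFintype_apply, ENNReal.toReal_ofReal h0, mul_comm]

theorem isExperiment_estimateTerm {T : ℕ} (hT : 1 ≤ T) (k : Q → Fin 2)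
    (i j i' j' : Fin D → Fin 2) :
    IsExperiment (estimateTerm π₁ π₂ E₁ E₂ ρ T k i j i' j') 4 (8 * T)
      (1 / 2 * ∑ l, runMean π₁ π₂ E₁ E₂ ρ k i j i' j' l) := by
  have h := (IsExperiment.indepSum_map (Finset.univ : Finset Label).toList fun l =>
    (isExperiment_runOnce π₁ π₂ E₁ E₂ ρ k i j i' j' l).meanOf hT).scale
      (c := 1 / 2) (by norm_num)
  have hcard : (Finset.univ : Finset Label).card = 8 := rfl
  rw [Finset.sum_map_toList, Finset.length_toList, hcard] at h
  convert h using 1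
  · rfl
  · norm_num
  · rw [mul_one]

theorem isExperiment_estimateStabilizer {T : ℕ} (hT : 1 ≤ T) (k : Q → Fin 2) :
    IsExperiment (estimateStabilizer π₁ π₂ E₁ E₂ ρ T T k) (4 ^ (D + 1)) (T * (8 * T))
      (4 ^ D * ((16 ^ D)⁻¹ * ∑ a : (Fin D → Fin 2) × (Fin D → Fin 2) × (Fin D → Fin 2) ×
        (Fin D → Fin 2), 1 / 2 * ∑ l, runMean π₁ π₂ E₁ E₂ ρ k a.1 a.2.1 a.2.2.1 a.2.2.2 l)) := by
  have h := ((IsExperiment.uniform_bind fun a : (Fin D → Fin 2) × (Fin D → Fin 2) ×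
    (Fin D → Fin 2) × (Fin D → Fin 2) => isExperiment_estimateTerm π₁ π₂ E₁ E₂ ρ hT k
      a.1 a.2.1 a.2.2.1 a.2.2.2).meanOf hT).scale (c := 4 ^ D) (by positivity)
  convert h using 1
  · rfl
  · rw [pow_succ]
  · have h16 : (16 : ℝ) ^ D = 2 ^ D * (2 ^ D * (2 ^ D * 2 ^ D)) := by
      rw [show (16 : ℝ) = 2 * (2 * (2 * 2)) by norm_num]
      simp only [mul_pow]
    simp [h16, mul_comm]

/-- The mean of the output of the algorithm. -/
noncomputable def algorithmMean : ℝ :=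
  (2 ^ Fintype.card Q)⁻¹ * ∑ k : Q → Fin 2,
    4 ^ D * ((16 ^ D)⁻¹ * ∑ a : (Fin D → Fin 2) × (Fin D → Fin 2) × (Fin D → Fin 2) ×
      (Fin D → Fin 2), 1 / 2 * ∑ l, runMean π₁ π₂ E₁ E₂ ρ k a.1 a.2.1 a.2.2.1 a.2.2.2 l)

theorem isExperiment_uniform_estimateStabilizer {T : ℕ} (hT : 1 ≤ T) :
    IsExperiment ((PMF.uniformOfFintype (Q → Fin 2)).bind fun k =>
      estimateStabilizer π₁ π₂ E₁ E₂ ρ T T k) (4 ^ (D + 1)) (T * (8 * T))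
      (algorithmMean π₁ π₂ E₁ E₂ ρ) := by
  convert IsExperiment.uniform_bind fun k : Q → Fin 2 =>
    isExperiment_estimateStabilizer π₁ π₂ E₁ E₂ ρ hT k using 1
  simp [algorithmMean]

/-! ### The bias caused by the imperfect operations -/

theorem abs_avg_sub_avg_le {ι : Type*} (s : Finset ι) {f g : ι → ℝ} {e c : ℝ}
    (hc : c * s.card = 1) (hc0 : 0 ≤ c) (h : ∀ i ∈ s, |f i - g i| ≤ e) :
    |c * ∑ i ∈ s, f i - c * ∑ i ∈ s, g i| ≤ e := by
  rw [← mul_sub, ← Finset.sum_sub_distrib, abs_mul, abs_of_nonneg hc0]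
  calc c * |∑ i ∈ s, (f i - g i)| ≤ c * (s.card * e) := by
        refine mul_le_mul_of_nonneg_left ?_ hc0
        refine (Finset.abs_sum_le_sum_abs _ _).trans ?_
        simpa using Finset.sum_le_card_nsmul s _ e h
    _ = e := by rw [← mul_assoc, hc, one_mul]

/-- The ideal mean of half the sum over all labels; the two terms come from
the two off-diagonal entries of the observable `X` that the second box measures on its ancilla. -/
theorem half_sum_ideal (circ : List (Gate Q)) (k : Q → Fin 2) (i j i' j' : Fin D → Fin 2) :
    1 / 2 * ∑ l : Label, ∑ x, betaValue π₁ π₂ k i j i' j' l x *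
      (((idealFirst A circ π₁ i i' l ⊗ₖ idealSecond A circ π₂ j j' l) * (ρ.load π₁ π₂).mat *
        (idealFirst A circ π₁ i i' l ⊗ₖ idealSecond A circ π₂ j j' l)ᴴ) x x).re =
      (1 / 2 * (quadTerm A circ ρ k i j i' j' + quadTerm A circ ρ k i' j' i j)).re := by
  have h := sum_label_ideal π₁ π₂ ρ k i j i' j' (branch (fun q => q ∈ A) circ (extendBits i))
    (branch (fun q => q ∈ A) circ (extendBits i')) (branch (fun q => q ∉ A) circ (extendBits j))
    (branch (fun q => q ∉ A) circ (extendBits j'))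
  have h1 : quadTerm A circ ρ k i j i' j' + quadTerm A circ ρ k i' j' i j = _ :=
    (by rw [quadTerm, quadTerm, add_comm (dotBits i' j'), ← mul_add] :
      quadTerm A circ ρ k i j i' j' + quadTerm A circ ρ k i' j' i j = _).trans h.symm
  rw [h1, show (1 / 2 : ℂ) = ((1 / 2 : ℝ) : ℂ) by push_cast; rfl, Complex.re_ofReal_mul]
  congr 1
  simp only [Complex.re_sum, Complex.re_ofReal_mul]
  rfl

theorem ideal_average (circ : List (Gate Q)) (hD : cutSize A circ = D) :
    (2 ^ Fintype.card Q : ℝ)⁻¹ * ∑ k : Q → Fin 2, 4 ^ D * ((16 ^ D)⁻¹ *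
      ∑ a : (Fin D → Fin 2) × (Fin D → Fin 2) × (Fin D → Fin 2) × (Fin D → Fin 2),
        (1 / 2 * (quadTerm A circ ρ k a.1 a.2.1 a.2.2.1 a.2.2.2 +
          quadTerm A circ ρ k a.2.2.1 a.2.2.2 a.1 a.2.1)).re) =
      fidelity (outputVector circ) ρ := by
  rw [← sum_trace_zString]
  congr 1
  refine Finset.sum_congr rfl fun k _ => ?_
  let sw : (Fin D → Fin 2) × (Fin D → Fin 2) × (Fin D → Fin 2) × (Fin D → Fin 2) ≃
      (Fin D → Fin 2) × (Fin D → Fin 2) × (Fin D → Fin 2) × (Fin D → Fin 2) :=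
    ⟨fun a => (a.2.2.1, a.2.2.2, a.1, a.2.1), fun a => (a.2.2.1, a.2.2.2, a.1, a.2.1),
      fun _ => rfl, fun _ => rfl⟩
  have h1 : ∑ a : (Fin D → Fin 2) × (Fin D → Fin 2) × (Fin D → Fin 2) × (Fin D → Fin 2),
      quadTerm A circ ρ k a.2.2.1 a.2.2.2 a.1 a.2.1 =
      ∑ a : (Fin D → Fin 2) × (Fin D → Fin 2) × (Fin D → Fin 2) × (Fin D → Fin 2),
        quadTerm A circ ρ k a.1 a.2.1 a.2.2.1 a.2.2.2 :=
    sw.sum_comp fun a => quadTerm A circ ρ k a.1 a.2.1 a.2.2.1 a.2.2.2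
  have h2 : ∑ a : (Fin D → Fin 2) × (Fin D → Fin 2) × (Fin D → Fin 2) × (Fin D → Fin 2),
      quadTerm A circ ρ k a.1 a.2.1 a.2.2.1 a.2.2.2 = _ :=
    (by simp only [Fintype.sum_prod_type] : _ = _).trans (sum_quadTerm A circ hD ρ k)
  rw [← Complex.re_sum, ← Finset.mul_sum, Finset.sum_add_distrib, h1, h2, ← two_mul,
    one_div, inv_mul_cancel_left₀ two_ne_zero]
  have h4 : (4 : ℂ) ^ D = ((4 ^ D : ℝ) : ℂ) := by
    push_cast
    rfl
  rw [h4, Complex.re_ofReal_mul, show (16 : ℝ) = 4 * 4 by norm_num, mul_pow]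
  field_simp

theorem abs_algorithmMean_sub_le (circ : List (Gate Q)) (hD : cutSize A circ = D) {ε : ℝ}
    (hε : 0 ≤ ε)
    (h₁ : ∀ i i' l, diamondNorm ((E₁ i i' l).map - conjMap (idealFirst A circ π₁ i i' l)) ≤
      ENNReal.ofReal (ε / 4 ^ (D + 2)))
    (h₂ : ∀ j j' l, diamondNorm ((E₂ j j' l).map - conjMap (idealSecond A circ π₂ j j' l)) ≤
      ENNReal.ofReal (ε / 4 ^ (D + 2))) :
    |algorithmMean π₁ π₂ E₁ E₂ ρ - fidelity (outputVector circ) ρ| ≤ ε / 2 := by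
  rw [← ideal_average ρ circ hD, algorithmMean]
  refine abs_avg_sub_avg_le _ (by simp) (by positivity) fun k _ => ?_
  rw [← mul_sub, abs_mul, abs_of_nonneg (by positivity)]
  -- The factor `8` is half the number of labels times the two boxes of each run.
  have hmain : 4 ^ D * (8 * (ε / 4 ^ (D + 2))) = ε / 2 := by
    rw [pow_add]
    field_simp
    ring
  rw [← hmain]
  refine mul_le_mul_of_nonneg_left ?_ (by positivity)
  refine abs_avg_sub_avg_le _ ?_ (by positivity) fun a _ => ?_
  · rw [show (16 : ℝ) = 2 * (2 * (2 * 2)) by norm_num]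
    simp [mul_pow]
    field_simp
  rw [← half_sum_ideal π₁ π₂ ρ circ k a.1 a.2.1 a.2.2.1 a.2.2.2, ← mul_sub,
    ← Finset.sum_sub_distrib, abs_mul, abs_of_nonneg (by norm_num)]
  have hl : ∀ l ∈ (Finset.univ : Finset Label), _ ≤ 2 * (ε / 4 ^ (D + 2)) := fun l _ =>
    abs_expectation_sub_le (by positivity) (ρ.load π₁ π₂) (E₁ a.1 a.2.2.1 l) (E₂ a.2.1 a.2.2.2 l)
      (idealFirst A circ π₁ a.1 a.2.2.1 l) (idealSecond A circ π₂ a.2.1 a.2.2.2 l)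
      (onDevice_conjTranspose_mul_self π₁ (firstBox_mem_unitaryGroup
        (by convert branch_mem_unitaryGroup (fun q => q ∈ A) circ (extendBits a.1))
        (by convert branch_mem_unitaryGroup (fun q => q ∈ A) circ (extendBits a.2.2.1)) l))
      (h₁ _ _ l) (h₂ _ _ l) (betaValue π₁ π₂ k a.1 a.2.1 a.2.2.1 a.2.2.2 l)
      fun x => (abs_betaValue π₁ π₂ k a.1 a.2.1 a.2.2.1 a.2.2.2 l x).le
  have h8 := (Finset.abs_sum_le_sum_abs _ _).trans (Finset.sum_le_card_nsmul _ _ _ hl)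
  have hcard : (Finset.univ : Finset Label).card = 8 := rfl
  rw [hcard, nsmul_eq_mul] at h8
  refine (mul_le_mul_of_nonneg_left h8 (by norm_num)).trans_eq ?_
  push_cast
  ring

end Algorithm

/-- The number of repetitions that Hoeffding's inequality asks for, and its size. -/
theorem exists_repetitions (D : ℕ) {ε δ : ℝ} (hε : 0 < ε) (hε1 : ε < 1) (hδ : 0 < δ) :
    ∃ T : ℕ, 1 ≤ T ∧
      ((8 * T ^ 3 : ℕ) : ℝ) ≤ 8 * 1025 ^ 3 *
        (2 ^ (12 * D) / ε ^ 6 * (max 1 ((D : ℝ) + Real.log (1 / (δ * ε ^ 4)))) ^ 3) ∧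
      2 * Real.exp (-(T * (ε / 2) ^ 2 / (8 * (4 ^ (D + 1)) ^ 2))) ≤ δ := by
  set L := max 1 ((D : ℝ) + Real.log (1 / (δ * ε ^ 4))) with hL
  have hL1 : 1 ≤ L := le_max_left _ _
  have hlog : Real.log (2 / δ) ≤ 2 * L := by
    have h1 : Real.log (1 / δ) ≤ Real.log (1 / (δ * ε ^ 4)) := by
      refine Real.log_le_log (by positivity) ?_
      refine one_div_le_one_div_of_le (by positivity) ?_
      exact mul_le_of_le_one_right hδ.le (pow_le_one₀ hε.le hε1.le)
    have h2 : Real.log (2 / δ) = Real.log 2 + Real.log (1 / δ) := by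
      rw [← Real.log_mul (by norm_num) (by positivity)]
      congr 1
      ring
    have h3 : Real.log 2 ≤ 1 := by linarith [Real.log_two_lt_d9]
    have h4 : (D : ℝ) + Real.log (1 / (δ * ε ^ 4)) ≤ L := le_max_right _ _
    have h5 : (0 : ℝ) ≤ D := by positivity
    linarith
  set x := 16 ^ D / ε ^ 2 * L with hx
  have hx1 : 1 ≤ x := by
    have h1 : 1 ≤ (16 : ℝ) ^ D / ε ^ 2 := by
      rw [le_div_iff₀ (by positivity), one_mul]
      exact (pow_le_one₀ hε.le hε1.le).trans (one_le_pow₀ (by norm_num))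
    exact one_le_mul_of_one_le_of_one_le h1 hL1
  -- With `T ≥ 1024 x` the exponent `T (ε / 2)² / (8 · 4^(2(D+1)))` is at least `2 L`.
  refine ⟨⌈1024 * x⌉₊, Nat.one_le_ceil_iff.2 (by linarith), ?_, ?_⟩
  · have h1 : (⌈1024 * x⌉₊ : ℝ) ≤ 1025 * x := by
      have := Nat.ceil_lt_add_one (a := 1024 * x) (by linarith)
      linarith
    have h2 : (⌈1024 * x⌉₊ : ℝ) ^ 3 ≤ (1025 * x) ^ 3 := by gcongr
    push_cast
    refine (mul_le_mul_of_nonneg_left h2 (by norm_num)).trans_eq ?_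
    have h3 : (2 : ℝ) ^ (12 * D) = (16 ^ D) ^ 3 := by
      rw [← pow_mul, show (16 : ℝ) = 2 ^ 4 by norm_num, ← pow_mul]
      congr 1
      ring
    rw [hx, h3]
    field_simp
  · have h1 : 1024 * x ≤ (⌈1024 * x⌉₊ : ℝ) := Nat.le_ceil _
    have h2 : 2 * L ≤ ⌈1024 * x⌉₊ * (ε / 2) ^ 2 / (8 * (4 ^ (D + 1)) ^ 2) := by
      have h3 : (4 ^ (D + 1) : ℝ) ^ 2 = 16 * 16 ^ D := by
        rw [← pow_mul, mul_comm, pow_mul, pow_succ]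
        norm_num [mul_comm]
      have h4 : 2 * L = 1024 * x * (ε / 2) ^ 2 / (8 * (4 ^ (D + 1)) ^ 2) := by
        rw [h3, hx]
        field_simp
        norm_num
      rw [h4]
      gcongr
    have h5 : Real.exp (-(⌈1024 * x⌉₊ * (ε / 2) ^ 2 / (8 * (4 ^ (D + 1)) ^ 2))) ≤ δ / 2 := by
      rw [← Real.le_log_iff_exp_le (by positivity), ← inv_div 2 δ, Real.log_inv]
      linarith
    linarith

end DivideConquer

theorem theorem1 :
    ∃ C : ℝ, 0 < C ∧ ∀ (D : ℕ) (ε δ : ℝ), 0 < ε → ε < 1 → 0 < δ → δ < 1 →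
      ∃ T : ℕ, 1 ≤ T ∧
        ((8 * T ^ 3 : ℕ) : ℝ) ≤
          C * (2 ^ (12 * D) / ε ^ 6 * (max 1 ((D : ℝ) + Real.log (1 / (δ * ε ^ 4)))) ^ 3) ∧
        ∀ (n m : ℕ) (circ : List (DivideConquer.Gate (Fin n))) (A : Finset (Fin n)),
          A.card = m → n ≤ 2 * m → DivideConquer.cutSize A circ = D →
          ∀ (π₁ : Option {q // q ∈ A} ↪ Fin (m + 1)) (π₂ : Option {q // q ∉ A} ↪ Fin (m + 1))
            (E₁ E₂ : (Fin D → Fin 2) → (Fin D → Fin 2) → DivideConquer.Label →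
              DivideConquer.Channel (Fin (m + 1) → Fin 2)),
            (∀ i i' l, DivideConquer.diamondNorm ((E₁ i i' l).map -
                DivideConquer.conjMap (DivideConquer.idealFirst A circ π₁ i i' l)) ≤
              ENNReal.ofReal (ε / 4 ^ (D + 2))) →
            (∀ j j' l, DivideConquer.diamondNorm ((E₂ j j' l).map -
                DivideConquer.conjMap (DivideConquer.idealSecond A circ π₂ j j' l)) ≤
              ENNReal.ofReal (ε / 4 ^ (D + 2))) →
            ∀ ρ : DivideConquer.State (Fin n → Fin 2),
              (∀ a ∈ (DivideConquer.divideAndConquer π₁ π₂ E₁ E₂ ρ T T T).support,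
                a.2 = 8 * T ^ 3) ∧
              ENNReal.ofReal (1 - δ) ≤
                (DivideConquer.divideAndConquer π₁ π₂ E₁ E₂ ρ T T T).toOuterMeasure
                  {a | |a.1 - DivideConquer.fidelity (DivideConquer.outputVector circ) ρ| ≤ ε} := by

  refine ⟨8 * 1025 ^ 3, by norm_num, fun D ε δ hε hε1 hδ _ => ?_⟩
  obtain ⟨T, hT, hsize, hexp⟩ := DivideConquer.exists_repetitions D hε hε1 hδ
  refine ⟨T, hT, hsize, fun n m circ A _ _ hD π₁ π₂ E₁ E₂ h₁ h₂ ρ => ?_⟩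
  have hp := DivideConquer.isExperiment_uniform_estimateStabilizer π₁ π₂ E₁ E₂ ρ hT
  have hbias := DivideConquer.abs_algorithmMean_sub_le π₁ π₂ E₁ E₂ ρ circ hD hε.le h₁ h₂
  refine ⟨fun a ha => ?_, ?_⟩
  · rw [(hp.meanOf hT).copies a ha]
    ring
  · refine (hp.hoeffding (by positivity) hT (by positivity) hexp).trans
      ((PMF.toOuterMeasure _).mono fun a ha => ?_)
    have ha' : |a.1 - DivideConquer.algorithmMean π₁ π₂ E₁ E₂ ρ| ≤ ε / 2 := ha
    have h := abs_add_le (a.1 - DivideConquer.algorithmMean π₁ π₂ E₁ E₂ ρ)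
      (DivideConquer.algorithmMean π₁ π₂ E₁ E₂ ρ -
        DivideConquer.fidelity (DivideConquer.outputVector circ) ρ)
    rw [sub_add_sub_cancel] at h
    exact h.trans (by linarith)
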